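/- Let $\alpha>0$, let $X_{0-}\ge 0$ be a random variable and $B$ a standard Brownian motion independent of $X_{0-}$. Let $(X,\Lambda)$ be a physical solution started from $X_{0-}$, that is: $\Lambda:[0,\infty)\to\mathbb{R}$ is non-decreasing and right-continuous with left limits, $$X_t=X_{0-}+B_t-\Lambda_t,\qquad \Lambda_t=\alpha\,\mathbb{P}(\tau\le t),\qquad t\ge 0,\qquad \tau:=\inf\{t\ge 0: X_t\le 0\},$$ and $$X_{t-}-X_t=\inf\Big\{x>0:\ \mathbb{P}\big(\tau\ge t,\ X_{t-}\in(0,x]\big)<\frac{x}{\alpha}\Big\},\qquad t\ge 0 .$$ Then, for every $t>0$, the restrictions to $(0,\infty)$ of the distributions of $X_t\mathbf{1}_{\{\tau\ge t\}}$ and of $X_{t-}\mathbf{1}_{\{\tau\ge t\}}$ have densities $p(t,\cdot)$ and $\rho(t,\cdot)$, respectively, and versions of these densities can be chosen for which the following holds. Let $\mathring D:=\{(t,x)\in(0,\infty)^2: x>\Lambda_t\}$ and $$u(t,x):=p(t,x-\Lambda_t),\qquad t>0,\ x>\Lambda_t .$$ 1. The function $u$ is $C^\infty$ in $(t,x)$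 on $\mathring D$ and satisfies $\partial_t u=\frac12\partial_{xx}u$ pointwise on $\mathring D$. 2. Every $(t,x)\in\mathring D$ has a neighborhood in $\mathbb{R}\times\mathbb{C}$ on which there exist extensions of $u$ and of its time derivatives of all orders that are analytic in the space variable, with jointly continuous space derivatives of all orders. 3. For every $t>0$, the function $u(t,\cdot)$ is real analytic on $(\Lambda_t,\infty)$, and the functions $p(t,\cdot)$ and $\rho(t,\cdot)$ are real analytic on $(0,\infty)$. -/

import Mathlib

open MeasureTheory ProbabilityTheory Filter Topology Set
open scoped NNReal ENNReal

namespace SupercooledStefan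

/-- The first time `τ = inf {t ≥ 0 : X_t ≤ 0}`, with value `⊤` if `X` stays positive. -/
noncomputable def absorptionTime {Ω : Type*} (X : ℝ≥0 → Ω → ℝ) : Ω → WithTop ℝ≥0 :=
  hittingAfter X (Iic (0 : ℝ)) 0

/-- The left limit `X_{t-}`, where `X_{0-}` is the given initial value. -/
noncomputable def leftValue {Ω : Type*} (X₀ : Ω → ℝ) (X : ℝ≥0 → Ω → ℝ) (t : ℝ≥0) (ω : Ω) : ℝ :=
  if t = 0 then X₀ ω else Function.leftLim (fun s => X s ω) t

/-- `(X, Λ)` is a physical solution, with parameter `α > 0`, started from the random variable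
`X₀ = X_{0-} ≥ 0` and driven by the standard Brownian motion `B`, independent of `X₀`. -/
structure IsPhysicalSolution {Ω : Type*} [MeasurableSpace Ω] (P : Measure Ω) (α : ℝ)
    (X₀ : Ω → ℝ) (B X : ℝ≥0 → Ω → ℝ) (Λ : ℝ≥0 → ℝ) : Prop where
  measurable_init : Measurable X₀
  init_nonneg : ∀ᵐ ω ∂P, 0 ≤ X₀ ω
  measurable_noise : ∀ t, Measurable (B t)
  brownian : IsBrownianReal B P
  indep : IndepFun X₀ (fun ω t => B t ω) P
  monotone : Monotone Λ
  right_continuous : ∀ t, ContinuousWithinAt Λ (Ici t) t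
  left_limits : ∀ t, ∃ l, Tendsto Λ (𝓝[<] t) (𝓝 l)
  /-- `X_t = X_{0-} + B_t - Λ_t`. -/
  dynamics : ∀ t ω, X t ω = X₀ ω + B t ω - Λ t
  /-- `Λ_t = α P(τ ≤ t)`. -/
  frontier : ∀ t : ℝ≥0, Λ t = α * P.real {ω | absorptionTime X ω ≤ (t : WithTop ℝ≥0)}
  /-- `X_{t-} - X_t = inf {x > 0 : P(τ ≥ t, X_{t-} ∈ (0, x]) < x / α}`. -/
  physical : ∀ t : ℝ≥0, ∀ᵐ ω ∂P, leftValue X₀ X t ω - X t ω =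
    sInf {x : ℝ | 0 < x ∧
      P.real {ω' | (t : WithTop ℝ≥0) ≤ absorptionTime X ω' ∧ leftValue X₀ X t ω' ∈ Ioc 0 x} < x / α}

/-- `g` is a (nonnegative) density, with respect to Lebesgue measure, of the restriction to
`(0, ∞)` of the distribution of the random variable `Y` under `P`. -/
structure IsSubdensity {Ω : Type*} [MeasurableSpace Ω] (P : Measure Ω) (Y : Ω → ℝ)
    (g : ℝ → ℝ) : Prop where
  aemeasurable_var : AEMeasurable Y P
  aemeasurable : AEMeasurable g (volume.restrict (Ioi 0))
  nonneg : ∀ x, 0 < x → 0 ≤ g x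
  law : (P.map Y).restrict (Ioi 0) =
    (volume.restrict (Ioi 0)).withDensity (fun x => ENNReal.ofReal (g x))

/-- The random variable `Y 1_{τ ≥ t}`, where `τ` is the absorption time of `X`. -/
noncomputable def beforeAbsorption {Ω : Type*} (X : ℝ≥0 → Ω → ℝ) (t : ℝ≥0) (Y : Ω → ℝ) : Ω → ℝ :=
  {ω | (t : WithTop ℝ≥0) ≤ absorptionTime X ω}.indicator Y

/-- The open liquid region `{(t, x) ∈ (0, ∞)² : x > Λ_t}`. -/
def liquidRegion (Λ : ℝ≥0 → ℝ) : Set (ℝ × ℝ) :=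
  {q | 0 < q.1 ∧ 0 < q.2 ∧ Λ q.1.toNNReal < q.2}

/-- `u(t, x) = p(t, x - Λ_t)`; only its values on the liquid region matter. -/
noncomputable def shiftedDensity (p : ℝ≥0 → ℝ → ℝ) (Λ : ℝ≥0 → ℝ) (t x : ℝ) : ℝ :=
  p t.toNNReal (x - Λ t.toNNReal)

/-- There is an open neighborhood `U` of `(t, x)` in `ℝ × ℂ`, whose real points lie in `D`, on
which all the time derivatives `∂ₜᵏ u`, `k = 0, 1, 2, …`, have extensions `E k` that are analytic
in the space variable, with all their complex space derivatives jointly continuous. -/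
def HasLocalComplexExtensions (u : ℝ → ℝ → ℝ) (D : Set (ℝ × ℝ)) (t x : ℝ) : Prop :=
  ∃ (U : Set (ℝ × ℂ)) (E : ℕ → ℝ → ℂ → ℂ), IsOpen U ∧ (t, (x : ℂ)) ∈ U ∧
    (∀ s y : ℝ, (s, (y : ℂ)) ∈ U → (s, y) ∈ D) ∧
    ∀ k : ℕ,
      (∀ s y : ℝ, (s, (y : ℂ)) ∈ U →
        E k s (y : ℂ) = ((iteratedDeriv k (fun r => u r y) s : ℝ) : ℂ)) ∧
      (∀ s : ℝ, AnalyticOnNhd ℂ (E k s) {z | (s, z) ∈ U}) ∧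
      ∀ l : ℕ, ContinuousOn (fun q : ℝ × ℂ => iteratedDeriv l (E k q.1) q.2) U

end SupercooledStefan

/-! Work in the fixed frame, with `X₀ + B` instead of `X`. The law of `X₀ + B_t` on `{τ ≥ t}` is its
full law minus its part on `{τ < t}`. The full law is the initial law smoothed by the heat kernel
`K`. By the strong Markov property at `τ`, the subtracted part has density `∫ K(t - s, x - y) ν(ds,
dy)`, where `ν` is the law of `(τ, X₀ + B_τ)`. Both terms are therefore heat potentials of finite
measures on space-time.

Lower semicontinuity of the paths gives `X_τ ≤ 0`, so `ν` charges only points with `y ≤ Λ_s`. Since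
`Λ` is monotone, a point `(t, x)` with `x > Λ_t` has a positive spatial distance from all sources
released up to a time `T > t` with `Λ_T < x`, which right-continuity provides; later sources are not
felt before `T`. Away from `(0, 0)`, in a complex cone around the real axis, `K` extended by zero to
`r ≤ 0` is smooth, holomorphic in `z` and bounded with all its derivatives, so one may differentiate
under the integral sign. The initial term is handled in the same way, since its sources sit at time
`0` and `t > 0`.

The carrying lemmas are `exists_gaussian_bound` and `hasFDerivAt_heatJet` (kernel),
`hasFDerivAt_heatPotential` (potentials), `setIntegral_strongMarkov` and `map_eval_alive`
(probability), and `isHeatJet_aliveJet`, where the two sides meet. The relation `∂ₜ = ½ ∂_zz` is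
built into `IsHeatJet`, from which smoothness, the heat equation and the complex extensions all
follow formally. -/

namespace SupercooledStefan

/-! ### The complexified heat kernel and its derivatives -/

/-- The space derivatives `∂_zʲ K`, `j = 0, 1, …`, of the complexified heat kernel
`K(r, z) = (2πr)^{-1/2} exp(-z² / (2r))`, extended by zero to `r ≤ 0`. -/
noncomputable def heatJet : ℕ → ℝ × ℂ → ℂ
  | 0, q => if 0 < q.1 then ((√(2 * Real.pi * q.1))⁻¹ : ℝ) * Complex.exp (-q.2 ^ 2 / (2 * q.1))
      else 0
  | 1, q => -(q.2 / q.1) * heatJet 0 q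
  | n + 2, q => -(q.2 * heatJet (n + 1) q + (n + 1) * heatJet n q) / q.1

lemma heatJet_one (q : ℝ × ℂ) : heatJet 1 q = -(q.2 / q.1) * heatJet 0 q := by
  conv_lhs => rw [heatJet]

lemma heatJet_add_two (n : ℕ) (q : ℝ × ℂ) :
    heatJet (n + 2) q = -(q.2 * heatJet (n + 1) q + (n + 1) * heatJet n q) / q.1 := by
  conv_lhs => rw [heatJet]

/-- The real-linear map `(s, z) ↦ s a + b z`. -/
noncomputable def jetMap (a b : ℂ) : ℝ × ℂ →L[ℝ] ℂ :=
  (ContinuousLinearMap.fst ℝ ℝ ℂ).smulRight a + b • ContinuousLinearMap.snd ℝ ℝ ℂ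

@[simp]
lemma jetMap_apply (a b : ℂ) (q : ℝ × ℂ) : jetMap a b q = q.1 * a + b * q.2 := by
  simp [jetMap]

lemma norm_jetMap_le (a b : ℂ) : ‖jetMap a b‖ ≤ ‖a‖ + ‖b‖ := by
  refine ContinuousLinearMap.opNorm_le_bound _ (by positivity) fun q => ?_
  rw [jetMap_apply]
  have h1 : ‖q.1‖ ≤ ‖q‖ := norm_fst_le q
  have h2 : ‖q.2‖ ≤ ‖q‖ := norm_snd_le q
  calc ‖(q.1 : ℂ) * a + b * q.2‖ ≤ ‖(q.1 : ℂ) * a‖ + ‖b * q.2‖ := norm_add_le _ _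
    _ = ‖q.1‖ * ‖a‖ + ‖b‖ * ‖q.2‖ := by simp
    _ ≤ ‖q‖ * ‖a‖ + ‖b‖ * ‖q‖ := by gcongr
    _ = (‖a‖ + ‖b‖) * ‖q‖ := by ring

lemma jetMap_eq_iff {L : ℝ × ℂ →L[ℝ] ℂ} {a b : ℂ} (h : ∀ q, L q = q.1 * a + b * q.2) :
    L = jetMap a b := by
  ext q <;> simp [h]

lemma heatJet_of_nonpos (n : ℕ) {q : ℝ × ℂ} (hq : q.1 ≤ 0) : heatJet n q = 0 := by
  induction n using Nat.twoStepInduction with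
  | zero => simp [heatJet, not_lt.2 hq]
  | one => simp [heatJet, not_lt.2 hq]
  | more n h0 h1 => simp [heatJet, h0, h1]

lemma measurable_heatJet (n : ℕ) : Measurable (heatJet n) := by
  have hz : Measurable (heatJet 0) := by
    have : heatJet 0 = fun q => if 0 < q.1 then ((√(2 * Real.pi * q.1))⁻¹ : ℝ) *
        Complex.exp (-q.2 ^ 2 / (2 * q.1)) else 0 := funext fun q => by rw [heatJet]
    rw [this]
    refine Measurable.ite (measurableSet_lt measurable_const measurable_fst) ?_ measurable_const
    fun_prop
  induction n using Nat.twoStepInduction with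
  | zero => exact hz
  | one =>
    rw [show heatJet 1 = fun q => -(q.2 / q.1) * heatJet 0 q from funext heatJet_one]
    fun_prop
  | more n h0 h1 =>
    rw [show heatJet (n + 2) = fun q => -(q.2 * heatJet (n + 1) q + (n + 1) * heatJet n q) / q.1
      from funext (heatJet_add_two n)]
    fun_prop

lemma hasFDerivAt_ofReal_fst (q : ℝ × ℂ) :
    HasFDerivAt (fun p : ℝ × ℂ => (p.1 : ℂ)) (jetMap 1 0) q :=
  (Complex.ofRealCLM.comp (ContinuousLinearMap.fst ℝ ℝ ℂ)).hasFDerivAt.congr_fderiv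
    (jetMap_eq_iff fun q => by simp)

lemma hasFDerivAt_snd_jetMap (q : ℝ × ℂ) :
    HasFDerivAt (fun p : ℝ × ℂ => p.2) (jetMap 0 1) q :=
  (ContinuousLinearMap.snd ℝ ℝ ℂ).hasFDerivAt.congr_fderiv (jetMap_eq_iff fun q => by simp)

lemma hasFDerivAt_heatJet_zero {q : ℝ × ℂ} (hq : 0 < q.1) :
    HasFDerivAt (heatJet 0) (jetMap (1 / 2 * heatJet 2 q) (heatJet 1 q)) q := by
  have hr : (q.1 : ℂ) ≠ 0 := by exact_mod_cast hq.ne'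
  have hev : heatJet 0 =ᶠ[𝓝 q] fun p => ((√(2 * Real.pi * p.1))⁻¹ : ℝ) *
      Complex.exp (-p.2 ^ 2 / (2 * p.1)) := by
    filter_upwards [(isOpen_lt continuous_const continuous_fst).mem_nhds hq] with p hp
    rw [heatJet, if_pos (show 0 < p.1 from hp)]
  have hpos : 0 < 2 * Real.pi * q.1 := by positivity
  have hs : HasDerivAt (fun r : ℝ => (√(2 * Real.pi * r))⁻¹)
      (-(√(2 * Real.pi * q.1))⁻¹ / (2 * q.1)) q.1 := by
    have h1 : HasDerivAt (fun r : ℝ => 2 * Real.pi * r) (2 * Real.pi) q.1 := by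
      simpa using (hasDerivAt_id q.1).const_mul (2 * Real.pi)
    have h2 := (h1.sqrt hpos.ne').inv (Real.sqrt_pos.2 hpos).ne'
    refine h2.congr_deriv ?_
    have h3 : √(2 * Real.pi * q.1) ≠ 0 := (Real.sqrt_pos.2 hpos).ne'
    rw [Real.sq_sqrt hpos.le]
    field_simp
  have hA : HasFDerivAt (fun p : ℝ × ℂ => (((√(2 * Real.pi * p.1))⁻¹ : ℝ) : ℂ))
      (jetMap ((-(√(2 * Real.pi * q.1))⁻¹ / (2 * q.1) : ℝ) : ℂ) 0) q := by
    have h1 := hs.ofReal_comp.hasFDerivAt.comp q (ContinuousLinearMap.fst ℝ ℝ ℂ).hasFDerivAt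
    exact h1.congr_fderiv (jetMap_eq_iff fun q => by simp)
  have hE : HasFDerivAt (fun p : ℝ × ℂ => Complex.exp (-p.2 ^ 2 / (2 * p.1)))
      (jetMap (Complex.exp (-q.2 ^ 2 / (2 * q.1)) * (q.2 ^ 2 / (2 * q.1 ^ 2)))
        (Complex.exp (-q.2 ^ 2 / (2 * q.1)) * (-q.2 / q.1))) q := by
    have h1 : HasFDerivAt (fun p : ℝ × ℂ => (2 * (p.1 : ℂ))⁻¹) _ q :=
      ((hasDerivAt_inv (mul_ne_zero two_ne_zero hr)).hasFDerivAt.restrictScalars ℝ).comp q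
        ((hasFDerivAt_ofReal_fst q).const_mul 2)
    have h2 := ((hasFDerivAt_snd_jetMap q).pow 2).neg.mul h1
    have h3 := ((Complex.hasDerivAt_exp (-q.2 ^ 2 / (2 * q.1))).hasFDerivAt.restrictScalars
      ℝ).comp q (h2.congr_of_eventuallyEq (Eventually.of_forall fun p => div_eq_mul_inv _ _))
    refine h3.congr_fderiv (jetMap_eq_iff fun p => ?_)
    simp
    field_simp
  refine ((hA.mul hE).congr_of_eventuallyEq hev).congr_fderiv (jetMap_eq_iff fun p => ?_)
  simp only [add_apply, smul_apply, jetMap_apply, heatJet_add_two, zero_add, heatJet_one,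
    show heatJet 0 q = _ from by rw [heatJet, if_pos hq], smul_eq_mul, Nat.cast_zero]
  push_cast
  field_simp
  ring

/-- Differentiating `r K₁ = -z K₀` repeatedly in `z` yields the recursion defining `heatJet`.
Conversely, differentiating the recursion propagates both `∂_z K_n = K_{n+1}` and the heat equation
from two consecutive orders to the next. -/
lemma hasFDerivAt_heatJet_of_pos (n : ℕ) {q : ℝ × ℂ} (hq : 0 < q.1) :
    HasFDerivAt (heatJet n) (jetMap (1 / 2 * heatJet (n + 2) q) (heatJet (n + 1) q)) q := by
  have hr : (q.1 : ℂ) ≠ 0 := by exact_mod_cast hq.ne'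
  have hinv : HasFDerivAt (fun p : ℝ × ℂ => (p.1 : ℂ)⁻¹) _ q :=
      ((hasDerivAt_inv hr).hasFDerivAt.restrictScalars ℝ).comp q (hasFDerivAt_ofReal_fst q)
  induction n using Nat.twoStepInduction with
  | zero => exact hasFDerivAt_heatJet_zero hq
  | one =>
    have h0 := hasFDerivAt_heatJet_zero hq
    have h := (((hasFDerivAt_snd_jetMap q).mul hinv).neg.mul h0).congr_of_eventuallyEq
      (f₁ := heatJet 1) (Eventually.of_forall fun p => by simp [heatJet_one, div_eq_mul_inv])
    refine h.congr_fderiv (jetMap_eq_iff fun p => ?_)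
    simp [-smul_add, heatJet_one, heatJet_add_two]
    field_simp
    ring
  | more n h0 h1 =>
    have h := (((((hasFDerivAt_snd_jetMap q).mul h1).add (h0.const_mul ((n : ℂ) + 1))).neg.mul
      hinv)).congr_of_eventuallyEq (f₁ := heatJet (n + 2))
      (Eventually.of_forall fun p => by simp [heatJet_add_two, div_eq_mul_inv])
    refine h.congr_fderiv (jetMap_eq_iff fun p => ?_)
    simp [-smul_add, heatJet_add_two]
    field_simp
    ring

/-! ### Bounds on the kernel away from its singularity -/

/-- A region, not approaching the singularity of the heat kernel, on which its space
derivatives of all orders are bounded. -/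
def heatDomain (M δ ε R : ℝ) : Set (ℝ × ℂ) :=
  {q | q.1 ≤ R ∧ ‖q.2‖ ^ 2 / 2 ≤ (q.2 ^ 2).re + M * max q.1 0 ∧ (δ ≤ q.1 ∨ ε ≤ ‖q.2‖)}

lemma exp_neg_le_factorial_div (N : ℕ) {x : ℝ} (hx : 0 < x) :
    Real.exp (-x) ≤ N.factorial / x ^ N := by
  rw [Real.exp_neg, inv_le_comm₀ (Real.exp_pos _) (by positivity), inv_div]
  exact Real.pow_div_factorial_le_exp x hx.le N

/-- On the domain `Re z² ≥ |z|²/2 - M r`, so the exponential is at most `e^{M/2} e^{-|z|²/(4r)}`.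
Where `|z| ≥ ε` this beats every power of `1/r`; elsewhere `r ≥ δ` and nothing is singular. -/
lemma exists_gaussian_bound {M δ ε R : ℝ} (hδ : 0 < δ) (hε : 0 < ε) (n k : ℕ) :
    ∃ C : ℝ, 0 ≤ C ∧ ∀ q ∈ heatDomain M δ ε R, 0 < q.1 →
      ‖q.2‖ ^ n * ‖Complex.exp (-q.2 ^ 2 / (2 * q.1))‖ ≤ C * q.1 ^ k := by
  -- With this exponent, `e^{-x} ≤ N!/x^N` at `x = |z|²/(4r)` leaves the factor `r^n r^k` and the
  -- negative power `|z|^{-(n+2k)}`, which `ε` controls. The constant below is the sum of those for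
  -- the two cases.
  set N := n + k with hN
  refine ⟨Real.exp (M / 2) * (N.factorial * 4 ^ N * |R| ^ n / ε ^ (n + 2 * k)) +
    Real.exp (M / 2) * (ε ^ n / δ ^ k), by positivity, ?_⟩
  rintro ⟨r, z⟩ ⟨h1, h2, h3⟩ (hr : 0 < r)
  simp only at h1 h2 h3 hr ⊢
  have hexp : ‖Complex.exp (-z ^ 2 / (2 * r))‖ ≤
      Real.exp (M / 2) * Real.exp (-(‖z‖ ^ 2 / (4 * r))) := by
    rw [Complex.norm_exp, ← Real.exp_add]
    apply Real.exp_le_exp.2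
    have : (-z ^ 2 / (2 * (r : ℂ))).re = -(z ^ 2).re / (2 * r) := by
      rw [show (2 * (r : ℂ)) = ((2 * r : ℝ) : ℂ) by push_cast; rfl, Complex.div_ofReal_re,
        Complex.neg_re]
    rw [this, max_eq_left hr.le] at *
    have h4 : M / 2 + -(‖z‖ ^ 2 / (4 * r)) = (M * r - ‖z‖ ^ 2 / 2) / (2 * r) := by
      field_simp
      ring
    rw [h4]
    gcongr
    linarith
  rw [add_mul]
  rcases le_or_gt ε ‖z‖ with hz | hz
  · have hz0 : 0 < ‖z‖ := hε.trans_le hz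
    have h5 := exp_neg_le_factorial_div N (x := ‖z‖ ^ 2 / (4 * r)) (by positivity)
    have h6 : ‖z‖ ^ n * (N.factorial / (‖z‖ ^ 2 / (4 * r)) ^ N) =
        N.factorial * 4 ^ N * r ^ n / ‖z‖ ^ (n + 2 * k) * r ^ k := by
      have e1 : (‖z‖ ^ 2 / (4 * r)) ^ N = ‖z‖ ^ n * ‖z‖ ^ (n + 2 * k) / (4 ^ N * (r ^ n * r ^ k))
          := by
        rw [div_pow, mul_pow, ← pow_add r, ← pow_mul, ← pow_add]
        congr 2
        omega
      rw [e1]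
      field_simp
    have h7 : 0 ≤ Real.exp (M / 2) * (ε ^ n / δ ^ k) * r ^ k := by positivity
    have hrR : r ≤ |R| := h1.trans (le_abs_self R)
    calc ‖z‖ ^ n * ‖Complex.exp (-z ^ 2 / (2 * r))‖
        ≤ ‖z‖ ^ n * (Real.exp (M / 2) * (N.factorial / (‖z‖ ^ 2 / (4 * r)) ^ N)) := by
          gcongr
          exact hexp.trans (by gcongr)
      _ = Real.exp (M / 2) * (N.factorial * 4 ^ N * r ^ n / ‖z‖ ^ (n + 2 * k)) * r ^ k := by
          rw [mul_left_comm, h6]; ring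
      _ ≤ Real.exp (M / 2) * (N.factorial * 4 ^ N * |R| ^ n / ε ^ (n + 2 * k)) * r ^ k := by
          gcongr
      _ ≤ _ := le_add_of_nonneg_right h7
  · have hr' : δ ≤ r := h3.resolve_right (not_le.2 hz)
    have h7 : 0 ≤ Real.exp (M / 2) * (N.factorial * 4 ^ N * |R| ^ n / ε ^ (n + 2 * k)) * r ^ k := by
      positivity
    have h8 : ‖Complex.exp (-z ^ 2 / (2 * r))‖ ≤ Real.exp (M / 2) := by
      refine hexp.trans (mul_le_of_le_one_right (Real.exp_pos _).le ?_)
      rw [Real.exp_le_one_iff, neg_nonpos]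
      positivity
    have h9 : ε ^ n ≤ ε ^ n / δ ^ k * r ^ k := by
      rw [div_mul_eq_mul_div, le_div_iff₀ (by positivity)]
      gcongr
    calc ‖z‖ ^ n * ‖Complex.exp (-z ^ 2 / (2 * r))‖ ≤ ε ^ n * Real.exp (M / 2) := by gcongr
      _ ≤ ε ^ n / δ ^ k * r ^ k * Real.exp (M / 2) := by gcongr
      _ = Real.exp (M / 2) * (ε ^ n / δ ^ k) * r ^ k := by ring
      _ ≤ _ := le_add_of_nonneg_left h7

/-- The prefactor `(2πr)^{-1/2}` is at most `(r + 1)/r`, so it costs a single power of `r`, taken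
from the Gaussian bound. -/
lemma exists_heatJet_zero_bound {M δ ε R : ℝ} (hδ : 0 < δ) (hε : 0 < ε) (n k : ℕ) :
    ∃ C : ℝ, 0 ≤ C ∧ ∀ q ∈ heatDomain M δ ε R, 0 < q.1 →
      ‖q.2‖ ^ n * ‖heatJet 0 q‖ ≤ C * q.1 ^ k := by
  obtain ⟨C, hC, h⟩ := exists_gaussian_bound (M := M) (R := R) hδ hε n (k + 1)
  refine ⟨(|R| + 1) * C, by positivity, fun q hq hr => ?_⟩
  have hrR : q.1 ≤ |R| := hq.1.trans (le_abs_self R)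
  have h1 : (√(2 * Real.pi * q.1))⁻¹ ≤ (q.1 + 1) / q.1 := by
    rw [inv_le_comm₀ (Real.sqrt_pos.2 (by positivity)) (by positivity), inv_div]
    apply Real.le_sqrt_of_sq_le
    have h2 : (q.1 / (q.1 + 1)) ^ 2 ≤ q.1 := by
      rw [div_pow, div_le_iff₀ (by positivity)]
      nlinarith [pow_pos hr 2, pow_pos hr 3]
    nlinarith [Real.pi_gt_three]
  have h2 : ‖heatJet 0 q‖ = (√(2 * Real.pi * q.1))⁻¹ *
      ‖Complex.exp (-q.2 ^ 2 / (2 * q.1))‖ := by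
    rw [heatJet, if_pos hr, norm_mul, Complex.norm_real, Real.norm_of_nonneg (by positivity)]
  calc ‖q.2‖ ^ n * ‖heatJet 0 q‖
      = (√(2 * Real.pi * q.1))⁻¹ * (‖q.2‖ ^ n * ‖Complex.exp (-q.2 ^ 2 / (2 * q.1))‖) := by
        rw [h2]; ring
    _ ≤ ((q.1 + 1) / q.1) * (C * q.1 ^ (k + 1)) := by
        exact mul_le_mul h1 (h q hq hr) (by positivity) (by positivity)
    _ = (q.1 + 1) * C * q.1 ^ k := by field_simp; ring
    _ ≤ (|R| + 1) * C * q.1 ^ k := by gcongr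

/-- Each step of the recursion multiplies by `z` and divides by `r`, so the induction needs the
bound for all powers `n` and `k` at once. -/
lemma exists_heatJet_bound_of_pos {M δ ε R : ℝ} (hδ : 0 < δ) (hε : 0 < ε) (j n k : ℕ) :
    ∃ C : ℝ, 0 ≤ C ∧ ∀ q ∈ heatDomain M δ ε R, 0 < q.1 →
      ‖q.2‖ ^ n * ‖heatJet j q‖ ≤ C * q.1 ^ k := by
  induction j using Nat.twoStepInduction generalizing n k with
  | zero => exact exists_heatJet_zero_bound hδ hε n k
  | one =>
    obtain ⟨C, hC, h⟩ := exists_heatJet_zero_bound (M := M) (R := R) hδ hε (n + 1) (k + 1)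
    refine ⟨C, hC, fun q hq hr => ?_⟩
    have h1 : ‖q.2‖ ^ n * ‖heatJet 1 q‖ = (‖q.2‖ ^ (n + 1) * ‖heatJet 0 q‖) / q.1 := by
      rw [heatJet_one, norm_mul, norm_neg, norm_div, Complex.norm_real, Real.norm_of_nonneg hr.le]
      ring
    rw [h1, div_le_iff₀ hr]
    exact (h q hq hr).trans_eq (by ring)
  | more j h0 h1 =>
    obtain ⟨C, hC, h⟩ := h1 (n + 1) (k + 1)
    obtain ⟨C', hC', h'⟩ := h0 n (k + 1)
    refine ⟨C + (j + 1) * C', by positivity, fun q hq hr => ?_⟩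
    have h2 : ‖q.2‖ ^ n * ‖heatJet (j + 2) q‖ ≤ (‖q.2‖ ^ (n + 1) * ‖heatJet (j + 1) q‖ +
        (j + 1) * (‖q.2‖ ^ n * ‖heatJet j q‖)) / q.1 := by
      rw [heatJet]
      simp only [norm_neg, norm_div, Complex.norm_real, Real.norm_of_nonneg hr.le]
      rw [← mul_div_assoc]
      gcongr
      refine (mul_le_mul_of_nonneg_left (norm_add_le _ _) (by positivity)).trans_eq ?_
      have : ‖(j : ℂ) + 1‖ = j + 1 := by exact_mod_cast Complex.norm_natCast (j + 1)
      rw [norm_mul, norm_mul, this]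
      ring
    refine h2.trans ?_
    rw [div_le_iff₀ hr]
    calc _ ≤ C * q.1 ^ (k + 1) + (j + 1) * (C' * q.1 ^ (k + 1)) := by
          have := mul_le_mul_of_nonneg_left (h' q hq hr) (by positivity : (0 : ℝ) ≤ j + 1)
          linarith [h q hq hr]
      _ = _ := by ring

lemma exists_heatJet_bound {M δ ε R : ℝ} (hδ : 0 < δ) (hε : 0 < ε) (j k : ℕ) :
    ∃ C : ℝ, 0 ≤ C ∧ ∀ q ∈ heatDomain M δ ε R, ‖heatJet j q‖ ≤ C * max q.1 0 ^ k := by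
  obtain ⟨C, hC, h⟩ := exists_heatJet_bound_of_pos (M := M) (R := R) hδ hε j 0 k
  refine ⟨C, hC, fun q hq => ?_⟩
  rcases le_or_gt q.1 0 with hr | hr
  · rw [heatJet_of_nonpos j hr]
    simpa using by positivity
  · simpa [max_eq_left hr.le] using h q hq hr

/-- At `r ≤ 0` the bound by `max r 0 ^ 2` makes the function quadratically small around the point.
Its derivative is then zero, in agreement with the zero extension of the higher jets. -/
lemma hasFDerivAt_heatJet {M δ ε R : ℝ} (hδ : 0 < δ) (hε : 0 < ε) (n : ℕ) {q : ℝ × ℂ}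
    (hq : heatDomain M δ ε R ∈ 𝓝 q) :
    HasFDerivAt (heatJet n) (jetMap (1 / 2 * heatJet (n + 2) q) (heatJet (n + 1) q)) q := by
  rcases lt_or_ge 0 q.1 with hr | hr
  · exact hasFDerivAt_heatJet_of_pos n hr
  obtain ⟨C, -, h⟩ := exists_heatJet_bound (M := M) (R := R) hδ hε n 2
  have h0 : jetMap (1 / 2 * heatJet (n + 2) q) (heatJet (n + 1) q) = 0 := by
    ext <;> simp [heatJet_of_nonpos _ hr]
  rw [h0]
  refine Asymptotics.IsBigO.hasFDerivAt (n := 2) (Asymptotics.IsBigO.of_bound |C| ?_) one_lt_two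
  filter_upwards [hq] with p hp
  have h1 : max p.1 0 ≤ ‖p - q‖ := by
    refine max_le (le_trans ?_ (norm_fst_le (p - q))) (norm_nonneg _)
    exact le_trans (by simpa using hr) (le_abs_self (p.1 - q.1))
  calc ‖heatJet n p‖ ≤ C * max p.1 0 ^ 2 := h p hp
    _ ≤ |C| * ‖p - q‖ ^ 2 := by
      gcongr
      exact le_abs_self C
    _ = |C| * ‖‖p - q‖ ^ 2‖ := by simp

/-! ### Heat potentials of measures on space-time -/

/-- The point `(s, y)` of `ℝ × ℝ` seen as a point of `ℝ × ℂ`. -/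
def complexify (p : ℝ × ℝ) : ℝ × ℂ := (p.1, (p.2 : ℂ))

@[fun_prop]
lemma continuous_complexify : Continuous complexify := by
  unfold complexify
  fun_prop

/-- The `n`-th space derivative of the heat potential of a measure on space-time. -/
noncomputable def heatPotential (ν : Measure (ℝ × ℝ)) (n : ℕ) (q : ℝ × ℂ) : ℂ :=
  ∫ p, heatJet n (q - complexify p) ∂ν

/-- The sources in `ν` are uniformly separated from a neighborhood of `q₀`. -/
def HeatRegular (ν : Measure (ℝ × ℝ)) (q₀ : ℝ × ℂ) : Prop :=
  ∃ η M δ ε R : ℝ, 0 < η ∧ 0 < δ ∧ 0 < ε ∧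
    ∀ᵐ p ∂ν, ∀ q ∈ Metric.ball q₀ η, q - complexify p ∈ heatDomain M δ ε R

/-- `F` is a sequence of functions of `(t, z)` which behaves on `U` like the sequence of the space
derivatives of a solution of the heat equation. -/
def IsHeatJet (F : ℕ → ℝ × ℂ → ℂ) (U : Set (ℝ × ℂ)) : Prop :=
  ∀ n, ∀ q ∈ U, HasFDerivAt (F n) (jetMap (1 / 2 * F (n + 2) q) (F (n + 1) q)) q

lemma measurable_heatJet_sub (n : ℕ) (q : ℝ × ℂ) :
    Measurable fun p => heatJet n (q - complexify p) :=
  (measurable_heatJet n).comp (continuous_const.sub continuous_complexify).measurable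

/-- Differentiation under the integral sign: regularity bounds every jet by a constant, uniformly
over almost all sources and over a ball around `q₀`, and `ν` is finite. -/
lemma hasFDerivAt_heatPotential {ν : Measure (ℝ × ℝ)} [IsFiniteMeasure ν] {q₀ : ℝ × ℂ}
    (h : HeatRegular ν q₀) (n : ℕ) :
    HasFDerivAt (heatPotential ν n)
      (jetMap (1 / 2 * heatPotential ν (n + 2) q₀) (heatPotential ν (n + 1) q₀)) q₀ := by
  obtain ⟨η, M, δ, ε, R, hη, hδ, hε, h⟩ := h
  have hbound : ∀ j, ∃ C : ℝ, ∀ᵐ p ∂ν, ∀ q ∈ Metric.ball q₀ η,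
      ‖heatJet j (q - complexify p)‖ ≤ C := fun j => by
    obtain ⟨C, -, hC⟩ := exists_heatJet_bound (M := M) (R := R) hδ hε j 0
    refine ⟨C, h.mono fun p hp q hq => ?_⟩
    simpa using hC _ (hp q hq)
  have hint : ∀ j, Integrable (fun p => heatJet j (q₀ - complexify p)) ν := fun j => by
    obtain ⟨C, hC⟩ := hbound j
    exact Integrable.of_bound (measurable_heatJet_sub j q₀).aestronglyMeasurable C
      (hC.mono fun p hp => hp q₀ (Metric.mem_ball_self hη))
  let F' : ℝ × ℂ → ℝ × ℝ → (ℝ × ℂ →L[ℝ] ℂ) := fun q p =>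
    jetMap (1 / 2 * heatJet (n + 2) (q - complexify p)) (heatJet (n + 1) (q - complexify p))
  -- Being real-linear in its coefficients, `jetMap` commutes with the integral, which identifies
  -- the derivative.
  let J : ℂ × ℂ →L[ℝ] (ℝ × ℂ →L[ℝ] ℂ) := LinearMap.toContinuousLinearMap
    { toFun := fun c => jetMap c.1 c.2
      map_add' := fun c d => by ext <;> simp [add_mul]
      map_smul' := fun r c => by ext <;> simp [mul_assoc] }
  have hi : Integrable (fun p => (1 / 2 * heatJet (n + 2) (q₀ - complexify p),
      heatJet (n + 1) (q₀ - complexify p))) ν :=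
    ((hint (n + 2)).const_mul (1 / 2)).prodMk (hint (n + 1))
  obtain ⟨C₁, hC₁⟩ := hbound (n + 1)
  obtain ⟨C₂, hC₂⟩ := hbound (n + 2)
  have key := hasFDerivAt_integral_of_dominated_of_fderiv_le (𝕜 := ℝ) (μ := ν) (x₀ := q₀)
    (F := fun q p => heatJet n (q - complexify p)) (F' := F') (bound := fun _ => C₂ + C₁)
    (Metric.ball_mem_nhds q₀ hη)
    (Eventually.of_forall fun q => (measurable_heatJet_sub n q).aestronglyMeasurable)
    (hint n) (J.integrable_comp hi).aestronglyMeasurable ?_ (integrable_const _) ?_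
  · refine key.congr_fderiv ?_
    have h1 : ∫ p, F' q₀ p ∂ν = J (∫ p, (1 / 2 * heatJet (n + 2) (q₀ - complexify p),
      heatJet (n + 1) (q₀ - complexify p)) ∂ν) := J.integral_comp_comm hi
    rw [h1, integral_pair ((hint (n + 2)).const_mul (1 / 2)) (hint (n + 1)), integral_const_mul]
    rfl
  · filter_upwards [hC₁, hC₂] with p h1 h2 q hq
    refine (norm_jetMap_le _ _).trans (add_le_add ?_ (h1 q hq))
    rw [norm_mul]
    refine le_trans ?_ (h2 q hq)
    exact mul_le_of_le_one_left (norm_nonneg _) (by norm_num)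
  · filter_upwards [h] with p hp q hq
    have hnhds : heatDomain M δ ε R ∈ 𝓝 (q - complexify p) := by
      have : (fun x => x + complexify p) ⁻¹' Metric.ball q₀ η ∈ 𝓝 (q - complexify p) :=
        (continuous_id.add continuous_const).continuousAt.preimage_mem_nhds
          (by simpa using Metric.isOpen_ball.mem_nhds hq)
      refine mem_of_superset this fun x hx => ?_
      simpa using hp _ hx
    have h1 := (hasFDerivAt_heatJet hδ hε n hnhds).comp q
      ((hasFDerivAt_id q).sub_const (complexify p))
    exact h1

lemma isHeatJet_heatPotential {ν : Measure (ℝ × ℝ)} [IsFiniteMeasure ν] {U : Set (ℝ × ℂ)}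
    (h : ∀ q ∈ U, HeatRegular ν q) : IsHeatJet (heatPotential ν) U :=
  fun n q hq => hasFDerivAt_heatPotential (h q hq) n

lemma IsHeatJet.sub {F G : ℕ → ℝ × ℂ → ℂ} {U : Set (ℝ × ℂ)} (hF : IsHeatJet F U)
    (hG : IsHeatJet G U) : IsHeatJet (fun n q => F n q - G n q) U := fun n q hq =>
  ((hF n q hq).sub (hG n q hq)).congr_fderiv (jetMap_eq_iff fun p => by simp; ring)

lemma mem_heatDomain_iff {M δ ε R : ℝ} {r : ℝ} {z : ℂ} : (r, z) ∈ heatDomain M δ ε R ↔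
    r ≤ R ∧ (z.re ^ 2 + z.im ^ 2) / 2 ≤ z.re ^ 2 - z.im ^ 2 + M * max r 0 ∧
      (δ ≤ r ∨ ε ≤ ‖z‖) := by
  unfold heatDomain
  rw [mem_ofPred_eq, Complex.sq_norm, Complex.normSq_apply]
  simp only [sq, Complex.mul_re]

/-- The sources may lie anywhere in space, but the elapsed time stays above `q₀.1 / 2`. The domain
condition amounts to `(3/2) Im² ≤ Re²/2 + M r`; as the imaginary part stays below `b`, a large `M`
achieves it. The value of `ε` plays no role. -/
lemma heatRegular_of_initial {ν : Measure (ℝ × ℝ)} (hν : ∀ᵐ p ∂ν, p.1 = 0) {q₀ : ℝ × ℂ}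
    (hq₀ : 0 < q₀.1) : HeatRegular ν q₀ := by
  set b := |q₀.2.im| + q₀.1 / 2 with hb
  refine ⟨q₀.1 / 2, 3 / 2 * b ^ 2 / (q₀.1 / 2), q₀.1 / 2, 1, q₀.1 + q₀.1 / 2, by positivity,
    by positivity, one_pos, hν.mono fun p hp q hq => ?_⟩
  rw [Metric.mem_ball, dist_eq_norm] at hq
  have h1 : |q.1 - q₀.1| < q₀.1 / 2 := (norm_fst_le (q - q₀)).trans_lt hq
  have h2 : |q.2.im - q₀.2.im| < q₀.1 / 2 := by
    refine lt_of_le_of_lt ?_ ((norm_snd_le (q - q₀)).trans_lt hq)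
    simpa using Complex.abs_im_le_norm (q.2 - q₀.2)
  have h3 : |q.2.im| ≤ b := by
    have := abs_sub_abs_le_abs_sub q.2.im q₀.2.im
    linarith
  rw [abs_lt] at h1
  change (q.1 - p.1, q.2 - (p.2 : ℂ)) ∈ _
  rw [mem_heatDomain_iff, hp, sub_zero]
  refine ⟨by linarith, ?_, Or.inl (by linarith)⟩
  have h4 : (q.2 - (p.2 : ℂ)).im = q.2.im := by simp
  have h5 : q.2.im ^ 2 ≤ b ^ 2 := by
    rw [← sq_abs q.2.im]
    gcongr
  have h6 : 3 / 2 * b ^ 2 ≤ 3 / 2 * b ^ 2 / (q₀.1 / 2) * max q.1 0 := by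
    rw [div_mul_eq_mul_div (3 / 2 * b ^ 2), le_div_iff₀ (by positivity)]
    gcongr
    exact le_trans (by linarith) (le_max_left _ _)
  rw [h4]
  nlinarith [sq_nonneg (q.2 - (p.2 : ℂ)).re]

/-- With `M = 0` the domain condition is `3 Im² ≤ Re²`, which the cone `2 |Im| ≤ Re` ensures. Moving
by `d / 6` costs at most `d / 6 + 2 d / 6 = d / 2` of the margin `d`, so a distance `ε = d / 2` from
the sources remains. -/
lemma heatRegular_of_le {ν : Measure (ℝ × ℝ)} {a : ℝ} (hν : ∀ᵐ p ∂ν, 0 ≤ p.1 ∧ p.2 ≤ a)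
    {q₀ : ℝ × ℂ} (hq₀ : 2 * |q₀.2.im| < q₀.2.re - a) : HeatRegular ν q₀ := by
  set d := q₀.2.re - a - 2 * |q₀.2.im| with hd
  have hd0 : 0 < d := by linarith
  refine ⟨d / 6, 0, 1, d / 2, q₀.1 + d / 6, by positivity, one_pos, by positivity,
    hν.mono fun p hp q hq => ?_⟩
  rw [Metric.mem_ball, dist_eq_norm] at hq
  have h1 : |q.1 - q₀.1| < d / 6 := (norm_fst_le (q - q₀)).trans_lt hq
  have h2 : |q.2.im - q₀.2.im| < d / 6 := by
    refine lt_of_le_of_lt ?_ ((norm_snd_le (q - q₀)).trans_lt hq)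
    simpa using Complex.abs_im_le_norm (q.2 - q₀.2)
  have h2' : |q.2.re - q₀.2.re| < d / 6 := by
    refine lt_of_le_of_lt ?_ ((norm_snd_le (q - q₀)).trans_lt hq)
    simpa using Complex.abs_re_le_norm (q.2 - q₀.2)
  have h3 := abs_sub_abs_le_abs_sub q.2.im q₀.2.im
  rw [abs_lt] at h1 h2'
  change (q.1 - p.1, q.2 - (p.2 : ℂ)) ∈ _
  rw [mem_heatDomain_iff]
  have h4 : (q.2 - (p.2 : ℂ)).im = q.2.im := by simp
  have h5 : (q.2 - (p.2 : ℂ)).re = q.2.re - p.2 := by simp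
  have h6 : d / 2 + 2 * |q.2.im| ≤ q.2.re - p.2 := by linarith [hp.2]
  have h7 := abs_nonneg q.2.im
  refine ⟨by linarith [hp.1], ?_, Or.inr ?_⟩
  · rw [h4, h5, ← sq_abs q.2.im]
    nlinarith
  · refine le_trans ?_ (Complex.re_le_norm _)
    rw [h5]
    linarith

/-- Causality: a source released at time `T` or later contributes nothing up to time `T`. -/
lemma heatPotential_restrict (ν : Measure (ℝ × ℝ)) (n : ℕ) {T : ℝ} {q : ℝ × ℂ} (hq : q.1 ≤ T) :
    heatPotential (ν.restrict {p | p.1 < T}) n q = heatPotential ν n q := by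
  refine setIntegral_eq_integral_of_forall_compl_eq_zero fun p hp => ?_
  refine heatJet_of_nonpos n ?_
  have : T ≤ p.1 := not_lt.1 hp
  change q.1 - p.1 ≤ 0
  linarith

/-! ### Regularity of heat jets -/

section HeatJet

variable {F : ℕ → ℝ × ℂ → ℂ} {U : Set (ℝ × ℂ)}

lemma IsHeatJet.mono {V : Set (ℝ × ℂ)} (hF : IsHeatJet F U) (h : V ⊆ U) : IsHeatJet F V :=
  fun n q hq => hF n q (h hq)

/-- In the space direction the real derivative is multiplication by a complex number, hence
complex-linear: these are the Cauchy–Riemann equations. -/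
lemma IsHeatJet.hasDerivAt_space (hF : IsHeatJet F U) (n : ℕ) {t : ℝ} {z : ℂ}
    (h : (t, z) ∈ U) : HasDerivAt (fun w => F n (t, w)) (F (n + 1) (t, z)) z := by
  have h1 : HasFDerivAt (fun w : ℂ => (t, w)) (ContinuousLinearMap.inr ℝ ℝ ℂ) z :=
    hasFDerivAt_prodMk_right t z
  have h2 := (hF n (t, z) h).comp z h1
  exact (hasFDerivAt_of_restrictScalars ℝ h2 (by ext; simp [mul_comm])).hasDerivAt.congr_deriv
    (f' := ContinuousLinearMap.toSpanSingleton ℂ (F (n + 1) (t, z)) 1) (by simp)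

lemma IsHeatJet.hasDerivAt_time (hF : IsHeatJet F U) (n : ℕ) {t : ℝ} {z : ℂ}
    (h : (t, z) ∈ U) : HasDerivAt (fun s => F n (s, z)) (1 / 2 * F (n + 2) (t, z)) t := by
  have h1 : HasFDerivAt (fun s : ℝ => (s, z)) (ContinuousLinearMap.inl ℝ ℝ ℂ) t :=
    hasFDerivAt_prodMk_left t z
  exact ((hF n (t, z) h).comp t h1).hasDerivAt.congr_deriv (by simp)

lemma IsHeatJet.continuousOn (hF : IsHeatJet F U) (n : ℕ) : ContinuousOn (F n) U :=
  fun q hq => (hF n q hq).continuousAt.continuousWithinAt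

lemma IsHeatJet.analyticAt_space (hF : IsHeatJet F U) (hU : IsOpen U) (n : ℕ) {t : ℝ} {z : ℂ}
    (h : (t, z) ∈ U) : AnalyticAt ℂ (fun w => F n (t, w)) z := by
  rw [Complex.analyticAt_iff_eventually_differentiableAt]
  have : ∀ᶠ w in 𝓝 z, (t, w) ∈ U :=
    (hU.preimage (by fun_prop : Continuous fun w : ℂ => (t, w))).mem_nhds h
  exact this.mono fun w hw => (hF.hasDerivAt_space n hw).differentiableAt

lemma IsHeatJet.iteratedDeriv_space (hF : IsHeatJet F U) (hU : IsOpen U) (n l : ℕ) {t : ℝ} {z : ℂ}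
    (h : (t, z) ∈ U) : iteratedDeriv l (fun w => F n (t, w)) z = F (n + l) (t, z) := by
  induction l generalizing z with
  | zero => simp
  | succ l ih =>
    have : ∀ᶠ w in 𝓝 z, (t, w) ∈ U :=
      (hU.preimage (by fun_prop : Continuous fun w : ℂ => (t, w))).mem_nhds h
    rw [iteratedDeriv_succ, Filter.EventuallyEq.deriv_eq (this.mono fun w hw => ih hw)]
    exact (hF.hasDerivAt_space (n + l) h).deriv

lemma hasDerivAt_re {f : ℝ → ℂ} {c : ℂ} {s : ℝ} (h : HasDerivAt f c s) :
    HasDerivAt (fun r => (f r).re) c.re s :=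
  (Complex.reCLM.hasFDerivAt.comp_hasDerivAt s h)

lemma hasDerivAt_im {f : ℝ → ℂ} {c : ℂ} {s : ℝ} (h : HasDerivAt f c s) :
    HasDerivAt (fun r => (f r).im) c.im s :=
  (Complex.imCLM.hasFDerivAt.comp_hasDerivAt s h)

lemma IsHeatJet.hasDerivAt_real_space (hF : IsHeatJet F U) (n : ℕ) {t x : ℝ}
    (h : (t, (x : ℂ)) ∈ U) :
    HasDerivAt (fun y : ℝ => F n (t, (y : ℂ))) (F (n + 1) (t, (x : ℂ))) x :=
  (hF.hasDerivAt_space n h).comp_ofReal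

/-- A heat jet whose first member is real at real points is real at real points. -/
lemma IsHeatJet.im_eq_zero (hF : IsHeatJet F U) (hU : IsOpen U)
    (h0 : ∀ s y : ℝ, (s, (y : ℂ)) ∈ U → (F 0 (s, (y : ℂ))).im = 0) (n : ℕ) {s y : ℝ}
    (h : (s, (y : ℂ)) ∈ U) : (F n (s, (y : ℂ))).im = 0 := by
  induction n generalizing y with
  | zero => exact h0 s y h
  | succ n ih =>
    have hev : ∀ᶠ w : ℝ in 𝓝 y, (s, (w : ℂ)) ∈ U :=
      (hU.preimage (by fun_prop : Continuous fun w : ℝ => (s, (w : ℂ)))).mem_nhds h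
    have h1 := hasDerivAt_im (hF.hasDerivAt_real_space n h)
    exact h1.unique ((hasDerivAt_const y (0 : ℝ)).congr_of_eventuallyEq (hev.mono fun w hw => ih
        hw))

lemma IsHeatJet.iteratedDeriv_time (hF : IsHeatJet F U) (hU : IsOpen U) (k : ℕ) {s y : ℝ}
    (h : (s, (y : ℂ)) ∈ U) : iteratedDeriv k (fun r => (F 0 (r, (y : ℂ))).re) s =
      ((1 / 2) ^ k * F (2 * k) (s, (y : ℂ))).re := by
  induction k generalizing s with
  | zero => simp
  | succ k ih =>
    have hev : ∀ᶠ r : ℝ in 𝓝 s, (r, (y : ℂ)) ∈ U :=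
      (hU.preimage (by fun_prop : Continuous fun r : ℝ => (r, (y : ℂ)))).mem_nhds h
    rw [iteratedDeriv_succ, Filter.EventuallyEq.deriv_eq (hev.mono fun r hr => ih hr)]
    rw [(hasDerivAt_re ((hF.hasDerivAt_time (2 * k) h).const_mul ((1 / 2) ^ k))).deriv, ← mul_assoc,
      ← pow_succ]
    rfl

/-- The derivative of one member is a combination of later members, so induction on `m`, for all `n`
simultaneously, gives every order of smoothness. -/
lemma IsHeatJet.contDiffAt (hF : IsHeatJet F U) (hU : IsOpen U) {q : ℝ × ℝ}
    (hq : complexify q ∈ U) (m : ℕ) (n : ℕ) :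
    ContDiffAt ℝ m (fun p => (F n (complexify p)).re) q := by
  have hV : IsOpen (complexify ⁻¹' U) := hU.preimage continuous_complexify
  suffices h : ∀ n, ContDiffOn ℝ m (fun p => (F n (complexify p)).re) (complexify ⁻¹' U) from
    (h n).contDiffAt (hV.mem_nhds hq)
  let ι : ℝ × ℝ →L[ℝ] ℝ × ℂ := (ContinuousLinearMap.fst ℝ ℝ ℝ).prod
    (Complex.ofRealCLM.comp (ContinuousLinearMap.snd ℝ ℝ ℝ))
  have hd : ∀ n, ∀ p ∈ complexify ⁻¹' U, HasFDerivAt (fun p => (F n (complexify p)).re)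
      (((1 / 2 : ℝ) * (F (n + 2) (complexify p)).re) • ContinuousLinearMap.fst ℝ ℝ ℝ +
        (F (n + 1) (complexify p)).re • ContinuousLinearMap.snd ℝ ℝ ℝ) p := fun n p hp => by
    have h1 := Complex.reCLM.hasFDerivAt.comp p ((hF n _ hp).comp p (ι.hasFDerivAt (x := p)))
    refine h1.congr_fderiv ?_
    ext <;> simp [ι]
  induction m with
  | zero => exact fun n => contDiffOn_zero.2 fun p hp => (hd n p hp).continuousAt.continuousWithinAt
  | succ m ih =>
    intro n
    push_cast
    rw [contDiffOn_succ_iff_fderiv_of_isOpen hV]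
    refine ⟨fun p hp => (hd n p hp).differentiableAt.differentiableWithinAt, by simp, ?_⟩
    refine ContDiffOn.congr ?_ fun p hp => (hd n p hp).fderiv
    exact ((contDiffOn_const.mul (ih (n + 2))).smul contDiffOn_const).add
      ((ih (n + 1)).smul contDiffOn_const)

lemma IsHeatJet.heat_equation (hF : IsHeatJet F U) (hU : IsOpen U) {t x : ℝ}
    (h : (t, (x : ℂ)) ∈ U) : deriv (fun s => (F 0 (s, (x : ℂ))).re) t =
      1 / 2 * iteratedDeriv 2 (fun y : ℝ => (F 0 (t, (y : ℂ))).re) x := by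
  have hev : ∀ᶠ w : ℝ in 𝓝 x, (t, (w : ℂ)) ∈ U :=
    (hU.preimage (by fun_prop : Continuous fun w : ℝ => (t, (w : ℂ)))).mem_nhds h
  rw [(hasDerivAt_re (hF.hasDerivAt_time 0 h)).deriv, iteratedDeriv_succ, iteratedDeriv_one,
    Filter.EventuallyEq.deriv_eq
      (hev.mono fun w hw => (hasDerivAt_re (hF.hasDerivAt_real_space 0 hw)).deriv),
    (hasDerivAt_re (hF.hasDerivAt_real_space 1 h)).deriv]
  simp

lemma IsHeatJet.analyticAt_real (hF : IsHeatJet F U) (hU : IsOpen U) {t x : ℝ}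
    (h : (t, (x : ℂ)) ∈ U) : AnalyticAt ℝ (fun y : ℝ => (F 0 (t, (y : ℂ))).re) x := by
  have h1 : AnalyticAt ℝ (fun w : ℂ => F 0 (t, w)) (Complex.ofRealCLM x) :=
    (hF.analyticAt_space hU 0 h).restrictScalars
  exact (Complex.reCLM.analyticAt _).comp (h1.comp (Complex.ofRealCLM.analyticAt x))

lemma IsHeatJet.hasLocalComplexExtensions (hF : IsHeatJet F U) (hU : IsOpen U) {u : ℝ → ℝ → ℝ}
    (hu : ∀ s y : ℝ, (s, (y : ℂ)) ∈ U → F 0 (s, (y : ℂ)) = (u s y : ℂ)) {D : Set (ℝ × ℝ)}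
    (hD : ∀ s y : ℝ, (s, (y : ℂ)) ∈ U → (s, y) ∈ D) {t x : ℝ} (h : (t, (x : ℂ)) ∈ U) :
    HasLocalComplexExtensions u D t x := by
  -- Since `∂ₜ = ½ ∂_zz`, the `k`-th time derivative is `2^{-k}` times the space derivative of order
  -- `2k`.
  refine ⟨U, fun k s z => (1 / 2) ^ k * F (2 * k) (s, z), hU, h, hD, fun k => ⟨?_, ?_, ?_⟩⟩
  · intro s y hs
    have hev : ∀ᶠ r : ℝ in 𝓝 s, (r, (y : ℂ)) ∈ U :=
      (hU.preimage (by fun_prop : Continuous fun r : ℝ => (r, (y : ℂ)))).mem_nhds hs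
    have h1 : (fun r => u r y) =ᶠ[𝓝 s] fun r => (F 0 (r, (y : ℂ))).re :=
      hev.mono fun r hr => by simp [hu r y hr]
    rw [h1.iteratedDeriv_eq, hF.iteratedDeriv_time hU k hs]
    have h2 := hF.im_eq_zero hU (fun s y hs => by simp [hu s y hs]) (2 * k) hs
    have h3 : F (2 * k) (s, (y : ℂ)) = ((F (2 * k) (s, (y : ℂ))).re : ℂ) :=
      Complex.ext (by simp) (by simp [h2])
    beta_reduce
    rw [h3, show ((1 : ℂ) / 2) ^ k = (((1 / 2) ^ k : ℝ) : ℂ) by push_cast; rfl,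
      ← Complex.ofReal_mul, Complex.ofReal_re]
  · exact fun s z hz => analyticAt_const.mul (hF.analyticAt_space hU (2 * k) hz)
  · intro l
    refine ((hF.continuousOn (2 * k + l)).const_smul ((1 / 2 : ℂ) ^ k)).congr fun q hq => ?_
    rw [iteratedDeriv_const_mul_field, hF.iteratedDeriv_space hU (2 * k) l hq]
    rfl

end HeatJet

/-! ### The Markov property at deterministic times -/

section Markov

open scoped BoundedContinuousFunction

variable {Ω : Type*} [MeasurableSpace Ω] {P : Measure Ω}

/-- The average of `f` under the Gaussian law of mean `y` and variance `r`. -/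
noncomputable def gaussAverage (f : ℝ →ᵇ ℝ) (r : ℝ≥0) (y : ℝ) : ℝ :=
  ∫ z, f (y + √r * z) ∂gaussianReal 0 1

/-- Scaling a fixed standard Gaussian by `√r` makes dominated convergence apply jointly in `(r, y)`,
including at variance `0`. -/
lemma continuous_gaussAverage (f : ℝ →ᵇ ℝ) :
    Continuous fun q : ℝ≥0 × ℝ => gaussAverage f q.1 q.2 := by
  refine continuous_of_dominated (bound := fun _ => ‖f‖) (fun q => ?_)
    (fun q => Eventually.of_forall fun z => f.norm_coe_le_norm _) (integrable_const _)
    (Eventually.of_forall fun z => ?_)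
  · exact (f.continuous.comp (by fun_prop)).aestronglyMeasurable
  · exact f.continuous.comp (by fun_prop)

lemma norm_gaussAverage_le (f : ℝ →ᵇ ℝ) (r : ℝ≥0) (y : ℝ) : ‖gaussAverage f r y‖ ≤ ‖f‖ := by
  refine (norm_integral_le_of_norm_le_const
    (Eventually.of_forall fun z => f.norm_coe_le_norm _)).trans_eq ?_
  simp

lemma map_sqrt_mul_gaussianReal (r : ℝ≥0) :
    (gaussianReal 0 1).map (fun z => √r * z) = gaussianReal 0 r := by
  rw [gaussianReal_map_const_mul]
  congr 1
  · simp
  · ext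
    simp

lemma gaussAverage_eq_integral (f : ℝ →ᵇ ℝ) (r : ℝ≥0) (y : ℝ) :
    gaussAverage f r y = ∫ z, f (y + z) ∂gaussianReal 0 r := by
  have hf : Continuous fun z => f (y + z) := f.continuous.comp (by fun_prop)
  rw [← map_sqrt_mul_gaussianReal, integral_map (by fun_prop) hf.aestronglyMeasurable]
  rfl

lemma gaussAverage_eq_integral_gaussianReal (f : ℝ →ᵇ ℝ) (r : ℝ≥0) (y : ℝ) :
    gaussAverage f r y = ∫ x, f x ∂gaussianReal y r := by
  have h : (gaussianReal 0 r).map (y + ·) = gaussianReal y r := by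
    rw [gaussianReal_map_const_add, zero_add]
  rw [gaussAverage_eq_integral, ← h, integral_map (by fun_prop)
    f.continuous.aestronglyMeasurable]

/-- The initial value together with the path of the noise up to time `s`. -/
def past (X₀ : Ω → ℝ) (B : ℝ≥0 → Ω → ℝ) (s : ℝ≥0) (ω : Ω) : ℝ × (Iic s → ℝ) :=
  (X₀ ω, fun v => B v ω)

lemma measurable_past {X₀ : Ω → ℝ} {B : ℝ≥0 → Ω → ℝ} (hX₀ : Measurable X₀)
    (hB : ∀ t, Measurable (B t)) (s : ℝ≥0) : Measurable (past X₀ B s) :=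
  hX₀.prodMk (measurable_pi_lambda _ fun v => hB v)

/-- If `X` is independent of the pair `(Y, Z)`, and `Y` of `Z`, then `(X, Y)` is independent
of `Z`. -/
lemma indepFun_prodMk_of_indepFun [IsProbabilityMeasure P] {α β γ : Type*} [MeasurableSpace α]
    [MeasurableSpace β] [MeasurableSpace γ] {X : Ω → α} {Y : Ω → β} {Z : Ω → γ}
    (hX : Measurable X) (hY : Measurable Y) (hZ : Measurable Z)
    (h : IndepFun X (fun ω => (Y ω, Z ω)) P) (hYZ : IndepFun Y Z P) :
    IndepFun (fun ω => (X ω, Y ω)) Z P := by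
  have hXY : IndepFun X Y P := h.comp measurable_id measurable_fst
  have h1 := h.map_prod_eq_prod_map_map hX.aemeasurable (hY.prodMk hZ).aemeasurable
  have h2 := hYZ.map_prod_eq_prod_map_map hY.aemeasurable hZ.aemeasurable
  have h3 := hXY.map_prod_eq_prod_map_map hX.aemeasurable hY.aemeasurable
  have := Measure.isProbabilityMeasure_map (μ := P) hX.aemeasurable
  have := Measure.isProbabilityMeasure_map (μ := P) hY.aemeasurable
  have := Measure.isProbabilityMeasure_map (μ := P) hZ.aemeasurable
  rw [indepFun_iff_map_prod_eq_prod_map_map (hX.prodMk hY).aemeasurable hZ.aemeasurable, h3]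
  apply MeasurableEquiv.prodAssoc.map_measurableEquiv_injective
  rw [Measure.map_map MeasurableEquiv.prodAssoc.measurable ((hX.prodMk hY).prodMk hZ)]
  rw [(measurePreserving_prodAssoc _ _ _).map_eq, ← h2, ← h1]
  rfl

/-- The Markov property of a Brownian motion with random initial value. -/
lemma setIntegral_markov [IsProbabilityMeasure P] {X₀ : Ω → ℝ} {B : ℝ≥0 → Ω → ℝ}
    (hX₀ : Measurable X₀) (hBm : ∀ t, Measurable (B t)) (hB : IsPreBrownianReal B P)
    (hind : IndepFun X₀ (fun ω t => B t ω) P) {s t : ℝ≥0} (hst : s ≤ t) (f : ℝ →ᵇ ℝ) {A : Set Ω}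
    (hA : MeasurableSet[MeasurableSpace.comap (past X₀ B s) inferInstance] A) :
    ∫ ω in A, f (X₀ ω + B t ω) ∂P = ∫ ω in A, gaussAverage f (t - s) (X₀ ω + B s ω) ∂P := by
  obtain ⟨A', hA', rfl⟩ := hA
  obtain ⟨r, rfl⟩ := exists_add_of_le hst
  rw [add_tsub_cancel_left]
  set W := past X₀ B s with hW
  set Z : Ω → ℝ := fun ω => B (s + r) ω - B s ω with hZ
  have hWm : Measurable W := measurable_past hX₀ hBm s
  have hZm : Measurable Z := (hBm _).sub (hBm _)
  have hBs : Measurable fun ω (v : Iic s) => B v ω := measurable_pi_lambda _ fun v => hBm v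
  -- The increment is independent of the noise up to time `s`, and `X₀` is independent of the whole
  -- noise; together these make it independent of the full past.
  have hWZ : IndepFun W Z P := by
    refine indepFun_prodMk_of_indepFun hX₀ hBs hZm ?_ ?_
    · exact hind.comp (φ := id) measurable_id
        (ψ := fun b : ℝ≥0 → ℝ => ((fun v : Iic s => b v), b (s + r) - b s)) (by fun_prop)
    · exact ((hB.indepFun_shift s).comp (φ := fun b : ℝ≥0 → ℝ => b r) (measurable_pi_apply r)
        measurable_id).symm
  have hlaw : P.map Z = gaussianReal 0 r := ((hB.shift s).hasLaw_eval r).map_eq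
  let h : ℝ × (Iic s → ℝ) → ℝ := fun w => w.1 + w.2 ⟨s, self_mem_Iic⟩
  have hh : Measurable h := by fun_prop
  have := Measure.isProbabilityMeasure_map (μ := P) hWm.aemeasurable
  have hmeas : StronglyMeasurable fun p : (ℝ × (Iic s → ℝ)) × ℝ => f (h p.1 + p.2) :=
    (f.continuous.measurable.comp (by fun_prop)).stronglyMeasurable
  have hpair := hWZ.map_prod_eq_prod_map_map hWm.aemeasurable hZm.aemeasurable
  rw [hlaw] at hpair
  calc ∫ ω in W ⁻¹' A', f (X₀ ω + B (s + r) ω) ∂P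
      = ∫ ω in (fun ω => (W ω, Z ω)) ⁻¹' (A' ×ˢ univ), f (h (W ω) + Z ω) ∂P := by
        rw [mk_preimage_prod, preimage_univ, inter_univ]
        congr 1 with ω
        simp [h, W, Z, past]
    _ = ∫ p in A' ×ˢ univ, f (h p.1 + p.2) ∂((P.map W).prod (gaussianReal 0 r)) := by
        rw [← hpair, setIntegral_map (hA'.prod MeasurableSet.univ) hmeas.aestronglyMeasurable
          (hWm.prodMk hZm).aemeasurable]
    _ = ∫ w in A', ∫ z, f (h w + z) ∂gaussianReal 0 r ∂(P.map W) := by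
        rw [setIntegral_prod, Measure.restrict_univ]
        exact (Integrable.of_bound hmeas.aestronglyMeasurable ‖f‖
          (Eventually.of_forall fun p => f.norm_coe_le_norm _)).integrableOn
    _ = ∫ w in A', gaussAverage f r (h w) ∂(P.map W) := by simp_rw [gaussAverage_eq_integral]
    _ = ∫ ω in W ⁻¹' A', gaussAverage f r (X₀ ω + B s ω) ∂P := by
        rw [setIntegral_map hA' _ hWm.aemeasurable]
        · rfl
        · exact ((continuous_gaussAverage f).measurable.comp
            (measurable_const.prodMk hh)).aestronglyMeasurable

end Markov

/-! ### The absorption time of a single path -/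

section Absorption

variable {Ω : Type*}

lemma absorptionTime_eq_coe_of_mem {X : ℝ≥0 → Ω → ℝ} {ω : Ω} (h : ∃ v, X v ω ≤ 0) :
    absorptionTime X ω = ((sInf {v | X v ω ≤ 0} : ℝ≥0) : WithTop ℝ≥0) := by
  obtain ⟨v, hv⟩ := h
  unfold absorptionTime hittingAfter
  rw [if_pos ⟨v, zero_le, hv⟩]
  simp
  rfl

lemma exists_of_absorptionTime_ne_top {X : ℝ≥0 → Ω → ℝ} {ω : Ω} (h : absorptionTime X ω ≠ ⊤) :
    ∃ v, X v ω ≤ 0 := by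
  by_contra hn
  exact h (hittingAfter_eq_top_iff.2 fun j _ hj => hn ⟨j, hj⟩)

/-- Sublevel sets of a lower semicontinuous path are closed, so the infimum is attained. -/
lemma absorptionTime_untopD_mem {X : ℝ≥0 → Ω → ℝ} {ω : Ω}
    (hX : LowerSemicontinuous fun v => X v ω) (h : absorptionTime X ω ≠ ⊤) :
    X ((absorptionTime X ω).untopD 0) ω ≤ 0 := by
  have h1 := exists_of_absorptionTime_ne_top h
  rw [absorptionTime_eq_coe_of_mem h1, WithTop.untopD_coe]
  exact (hX.isClosed_preimage 0).csInf_mem h1 (OrderBot.bddBelow _)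

lemma absorptionTime_le_iff {X : ℝ≥0 → Ω → ℝ} {ω : Ω} (hX : LowerSemicontinuous fun v => X v ω)
    (s : ℝ≥0) : absorptionTime X ω ≤ s ↔ ∃ v ≤ s, X v ω ≤ 0 := by
  constructor
  · intro h
    have hne : absorptionTime X ω ≠ ⊤ := fun h' =>
      absurd (h' ▸ h) (not_le.2 (WithTop.coe_lt_top s))
    refine ⟨(absorptionTime X ω).untopD 0, ?_, absorptionTime_untopD_mem hX hne⟩
    exact WithTop.untopD_le h
  · rintro ⟨v, hv, hv'⟩
    exact (hittingAfter_le_of_mem zero_le hv').trans (WithTop.coe_le_coe.2 hv)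

/-- For lower semicontinuous right-continuous paths, absorption before `s` is decided by a
countable set of times. -/
lemma absorptionTime_le_iff_countable {X : ℝ≥0 → Ω → ℝ} {ω : Ω}
    (hX : LowerSemicontinuous fun v => X v ω)
    (hX' : ∀ v, ContinuousWithinAt (fun v => X v ω) (Ici v) v) {D : Set ℝ≥0} (hD : Dense D)
    (s : ℝ≥0) : absorptionTime X ω ≤ s ↔
      ∀ n : ℕ, ∃ v ∈ insert s D, v ≤ s ∧ X v ω < 1 / ((n : ℝ) + 1) := by
  rw [absorptionTime_le_iff hX]
  constructor
  · rintro ⟨v, hv, hv'⟩ n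
    have hn : (0 : ℝ) < 1 / ((n : ℝ) + 1) := by positivity
    -- For `v = s` right-continuity would look beyond `s`; this is why `s` is added to the dense
    -- set.
    rcases hv.eq_or_lt with rfl | hlt
    · exact ⟨v, mem_insert _ _, le_rfl, hv'.trans_lt hn⟩
    · have h1 : ∀ᶠ w in 𝓝[>] v, X w ω < 1 / ((n : ℝ) + 1) :=
        ((hX' v).mono Ioi_subset_Ici_self).eventually_lt_const (hv'.trans_lt hn)
      obtain ⟨b, hb, hb'⟩ := (mem_nhdsGT_iff_exists_Ioo_subset' hlt).1 h1
      obtain ⟨w, hwD, hw⟩ := hD.exists_between (lt_min hb hlt)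
      exact ⟨w, mem_insert_of_mem _ hwD, (hw.2.trans_le (min_le_right _ _)).le,
        hb' ⟨hw.1, hw.2.trans_le (min_le_left _ _)⟩⟩
  · intro h
    -- A lower semicontinuous path attains its minimum on `[0, s]`, and that minimum is below every
    -- `1 / (n + 1)`.
    obtain ⟨v, hv, hmin⟩ := (hX.lowerSemicontinuousOn (Icc 0 s)).exists_isMinOn
      ⟨0, by simp⟩ isCompact_Icc
    refine ⟨v, hv.2, le_of_forall_pos_lt_add fun ε hε => ?_⟩
    obtain ⟨n, hn⟩ := exists_nat_one_div_lt hε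
    obtain ⟨w, -, hw, hw'⟩ := h n
    rw [zero_add]
    exact (hmin ⟨zero_le, hw⟩).trans_lt (hw'.trans hn)

end Absorption

/-! ### Brownian motion with a barrier: measurability of absorption -/

/-- `X = X₀ + B - Λ`, where `B` is a Brownian motion, independent of `X₀`, all of whose paths are
continuous, and `Λ` is a monotone right-continuous barrier. -/
structure IsBarrierMotion {Ω : Type*} [MeasurableSpace Ω] (P : Measure Ω)
    (X₀ : Ω → ℝ) (B X : ℝ≥0 → Ω → ℝ) (Λ : ℝ≥0 → ℝ) : Prop where
  measurable_init : Measurable X₀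
  measurable_noise : ∀ t, Measurable (B t)
  brownian : IsPreBrownianReal B P
  continuous_noise : ∀ ω, Continuous fun t => B t ω
  indep : IndepFun X₀ (fun ω t => B t ω) P
  monotone : Monotone Λ
  right_continuous : ∀ t, ContinuousWithinAt Λ (Ici t) t
  dynamics : ∀ t ω, X t ω = X₀ ω + B t ω - Λ t

/-- Jumps go upwards, and right-continuity assigns the upper value at a jump. -/
lemma upperSemicontinuous_of_monotone {Λ : ℝ≥0 → ℝ} (hm : Monotone Λ)
    (hr : ∀ t, ContinuousWithinAt Λ (Ici t) t) : UpperSemicontinuous Λ := by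
  intro t y hy
  rw [← nhdsLE_sup_nhdsGE, Filter.eventually_sup]
  refine ⟨?_, (hr t).eventually_lt_const hy⟩
  filter_upwards [self_mem_nhdsWithin] with s hs
  exact (hm hs).trans_lt hy

lemma comap_past_mono {Ω : Type*} (X₀ : Ω → ℝ) (B : ℝ≥0 → Ω → ℝ) {s t : ℝ≥0} (hst : s ≤ t) :
    MeasurableSpace.comap (past X₀ B s) inferInstance ≤
      MeasurableSpace.comap (past X₀ B t) inferInstance := by
  let π : ℝ × (Iic t → ℝ) → ℝ × (Iic s → ℝ) := fun w => (w.1, fun v => w.2 ⟨v, v.2.trans hst⟩)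
  have hπ : Measurable π := by fun_prop
  have h1 : past X₀ B s = π ∘ past X₀ B t := rfl
  rw [h1, ← MeasurableSpace.comap_comp]
  exact MeasurableSpace.comap_mono hπ.comap_le

namespace IsBarrierMotion

variable {Ω : Type*} [MeasurableSpace Ω] {P : Measure Ω} {X₀ : Ω → ℝ} {B X : ℝ≥0 → Ω → ℝ}
  {Λ : ℝ≥0 → ℝ}

lemma lowerSemicontinuous (h : IsBarrierMotion P X₀ B X Λ) (ω : Ω) :
    LowerSemicontinuous fun v => X v ω := by
  have h1 : LowerSemicontinuous fun v => -Λ v := fun t y hy => by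
    filter_upwards [upperSemicontinuous_of_monotone h.monotone h.right_continuous t (-y)
      (by linarith)] with s hs
    linarith
  have h2 : Continuous fun v => X₀ ω + B v ω := continuous_const.add (h.continuous_noise ω)
  simp_rw [h.dynamics, sub_eq_add_neg]
  exact h2.lowerSemicontinuous.add h1

lemma continuousWithinAt (h : IsBarrierMotion P X₀ B X Λ) (ω : Ω) (t : ℝ≥0) :
    ContinuousWithinAt (fun v => X v ω) (Ici t) t := by
  simp_rw [h.dynamics]
  exact (continuous_const.add (h.continuous_noise ω)).continuousWithinAt.sub
    (h.right_continuous t)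

/-- Countably many times up to `s` decide the event, so it lies in the uncompleted past, as the
Markov property requires. -/
lemma measurableSet_past_le (h : IsBarrierMotion P X₀ B X Λ) (s : ℝ≥0) :
    MeasurableSet[MeasurableSpace.comap (past X₀ B s) inferInstance]
      {ω | absorptionTime X ω ≤ s} := by
  obtain ⟨D, hDc, hD⟩ := TopologicalSpace.exists_countable_dense ℝ≥0
  have h1 : {ω | absorptionTime X ω ≤ s} =
      ⋂ n : ℕ, ⋃ v ∈ insert s D ∩ Iic s, {ω | X v ω < 1 / ((n : ℝ) + 1)} := by
    ext ω
    have := absorptionTime_le_iff_countable (h.lowerSemicontinuous ω) (h.continuousWithinAt ω) hD s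
    simp only [mem_ofPred_eq, this, mem_iInter, mem_iUnion, exists_prop, mem_inter_iff, mem_Iic,
      and_assoc]
  rw [h1]
  refine MeasurableSet.iInter fun n => MeasurableSet.biUnion
    ((hDc.insert s).mono inter_subset_left) fun v hv => ?_
  have hv' : v ≤ s := hv.2
  refine ⟨{w | w.1 + w.2 ⟨v, hv'⟩ - Λ v < 1 / ((n : ℝ) + 1)}, ?_, ?_⟩
  · exact measurableSet_lt (by fun_prop) measurable_const
  · ext ω
    simp [past, h.dynamics]

lemma measurableSet_past_lt (h : IsBarrierMotion P X₀ B X Λ) (s : ℝ≥0) :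
    MeasurableSet[MeasurableSpace.comap (past X₀ B s) inferInstance]
      {ω | absorptionTime X ω < s} := by
  obtain ⟨D, hDc, hD⟩ := TopologicalSpace.exists_countable_dense ℝ≥0
  have h1 : {ω | absorptionTime X ω < s} =
      ⋃ v ∈ insert 0 D ∩ Iio s, {ω | absorptionTime X ω ≤ v} := by
    ext ω
    simp only [mem_ofPred_eq, mem_iUnion, exists_prop, mem_inter_iff, mem_Iio]
    constructor
    · intro hlt
      obtain ⟨T, hT⟩ := WithTop.ne_top_iff_exists.1 (hlt.trans_le le_top).ne
      rw [← hT] at hlt ⊢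
      obtain ⟨w, hwD, hw⟩ := hD.exists_between (WithTop.coe_lt_coe.1 hlt)
      exact ⟨w, ⟨mem_insert_of_mem _ hwD, hw.2⟩, WithTop.coe_le_coe.2 hw.1.le⟩
    · rintro ⟨v, ⟨-, hv⟩, hle⟩
      exact hle.trans_lt (WithTop.coe_lt_coe.2 hv)
  rw [h1]
  refine MeasurableSet.biUnion ((hDc.insert 0).mono inter_subset_left) fun v hv => ?_
  exact comap_past_mono X₀ B (le_of_lt hv.2) _ (h.measurableSet_past_le v)

lemma comap_past_le (h : IsBarrierMotion P X₀ B X Λ) (s : ℝ≥0) :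
    MeasurableSpace.comap (past X₀ B s) inferInstance ≤ (inferInstance : MeasurableSpace Ω) :=
  (measurable_past h.measurable_init h.measurable_noise s).comap_le

lemma measurableSet_le (h : IsBarrierMotion P X₀ B X Λ) (s : ℝ≥0) :
    MeasurableSet {ω | absorptionTime X ω ≤ s} :=
  h.comap_past_le s _ (h.measurableSet_past_le s)

lemma measurableSet_lt (h : IsBarrierMotion P X₀ B X Λ) (s : ℝ≥0) :
    MeasurableSet {ω | absorptionTime X ω < s} :=
  h.comap_past_le s _ (h.measurableSet_past_lt s)

lemma measurableSet_ne_top (h : IsBarrierMotion P X₀ B X Λ) :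
    MeasurableSet {ω | absorptionTime X ω ≠ ⊤} := by
  have : {ω | absorptionTime X ω ≠ ⊤} = ⋃ n : ℕ, {ω | absorptionTime X ω ≤ ((n : ℝ≥0) : WithTop
      ℝ≥0)} := by
    ext ω
    simp only [mem_ofPred_eq, mem_iUnion]
    constructor
    · intro hne
      obtain ⟨T, hT⟩ := WithTop.ne_top_iff_exists.1 hne
      obtain ⟨n, hn⟩ := exists_nat_ge T
      exact ⟨n, by rw [← hT]; exact WithTop.coe_le_coe.2 hn⟩
    · rintro ⟨n, hn⟩
      exact (hn.trans_lt (WithTop.coe_lt_top _)).ne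
  rw [this]
  exact MeasurableSet.iUnion fun n => h.measurableSet_le n

/-- The real absorption time is measurable. -/
lemma measurable_untopD (h : IsBarrierMotion P X₀ B X Λ) :
    Measurable fun ω => (absorptionTime X ω).untopD 0 := by
  refine measurable_of_Iic fun s => ?_
  -- Paths that are never absorbed receive the default value `0` and so belong to every sublevel
  -- set.
  have : (fun ω => (absorptionTime X ω).untopD 0) ⁻¹' Iic s =
      {ω | absorptionTime X ω ≤ s} ∪ {ω | absorptionTime X ω ≠ ⊤}ᶜ := by
    ext ω
    simp only [mem_preimage, mem_Iic, mem_union, mem_compl_iff, mem_ofPred_eq, not_not]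
    rcases eq_or_ne (absorptionTime X ω) ⊤ with h' | h'
    · simp only [h', or_true, iff_true]
      exact zero_le
    · obtain ⟨T, hT⟩ := WithTop.ne_top_iff_exists.1 h'
      rw [← hT, WithTop.untopD_coe, WithTop.coe_le_coe]
      simp only [WithTop.coe_ne_top, or_false]
  rw [this]
  exact (h.measurableSet_le s).union h.measurableSet_ne_top.compl

lemma measurable_eval (h : IsBarrierMotion P X₀ B X Λ) {T : Ω → ℝ≥0} (hT : Measurable T) :
    Measurable fun ω => X₀ ω + B (T ω) ω :=
  h.measurable_init.add ((measurable_uncurry_of_continuous_of_measurable h.continuous_noise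
    h.measurable_noise).comp (hT.prodMk measurable_id))

end IsBarrierMotion

/-! ### The strong Markov property at the absorption time -/

section StrongMarkov

open scoped BoundedContinuousFunction

variable {Ω : Type*} [MeasurableSpace Ω] {P : Measure Ω}
  {X₀ : Ω → ℝ} {B X : ℝ≥0 → Ω → ℝ} {Λ : ℝ≥0 → ℝ}

/-- `T` rounded up, strictly, to a multiple of `δ`. -/
noncomputable def roundUp (δ T : ℝ≥0) : ℝ≥0 := ((⌊T / δ⌋₊ + 1 : ℕ) : ℝ≥0) * δ

lemma measurable_roundUp (δ : ℝ≥0) : Measurable (roundUp δ) := by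
  unfold roundUp
  have h1 : Measurable fun T : ℝ≥0 => ⌊T / δ⌋₊ := Nat.measurable_floor.comp (by fun_prop)
  have h2 : Measurable fun n : ℕ => ((n + 1 : ℕ) : ℝ≥0) := measurable_from_nat
  exact (h2.comp h1).mul_const δ

lemma lt_roundUp {δ : ℝ≥0} (hδ : 0 < δ) (T : ℝ≥0) : T < roundUp δ T := by
  unfold roundUp
  rw [← div_lt_iff₀ hδ]
  exact_mod_cast Nat.lt_floor_add_one (T / δ)

lemma roundUp_le {δ : ℝ≥0} (hδ : 0 < δ) (T : ℝ≥0) : roundUp δ T ≤ T + δ := by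
  unfold roundUp
  push_cast
  rw [add_mul, one_mul]
  gcongr
  rw [← le_div_iff₀ hδ]
  exact Nat.floor_le zero_le

lemma roundUp_eq {δ : ℝ≥0} (hδ : 0 < δ) {m : ℕ} {T : ℝ≥0} (h1 : m * δ ≤ T)
    (h2 : T < (m + 1 : ℕ) * δ) : roundUp δ T = (m + 1 : ℕ) * δ := by
  unfold roundUp
  have : ⌊T / δ⌋₊ = m := by
    rw [Nat.floor_eq_iff zero_le, le_div_iff₀ hδ, div_lt_iff₀ hδ]
    exact ⟨h1, by exact_mod_cast h2⟩
  rw [this]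

namespace IsBarrierMotion

lemma measurable_gaussAverage (h : IsBarrierMotion P X₀ B X Λ) (f : ℝ →ᵇ ℝ) (t : ℝ≥0)
    {R : Ω → ℝ≥0} (hR : Measurable R) :
    Measurable fun ω => gaussAverage f (t - R ω) (X₀ ω + B (R ω) ω) :=
  (continuous_gaussAverage f).measurable.comp
    ((measurable_const.sub hR).prodMk (h.measurable_eval hR))

variable [IsProbabilityMeasure P]

lemma integrableOn_comp (h : IsBarrierMotion P X₀ B X Λ) (f : ℝ →ᵇ ℝ) (t : ℝ≥0) (S : Set Ω) :
    IntegrableOn (fun ω => f (X₀ ω + B t ω)) S P :=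
  (Integrable.of_bound (f.continuous.measurable.comp
    (h.measurable_init.add (h.measurable_noise t))).aestronglyMeasurable ‖f‖
    (Eventually.of_forall fun _ => f.norm_coe_le_norm _)).integrableOn

lemma integrableOn_gaussAverage (h : IsBarrierMotion P X₀ B X Λ) (f : ℝ →ᵇ ℝ) (t : ℝ≥0)
    {R : Ω → ℝ≥0} (hR : Measurable R) (S : Set Ω) :
    IntegrableOn (fun ω => gaussAverage f (t - R ω) (X₀ ω + B (R ω) ω)) S P :=
  (Integrable.of_bound (h.measurable_gaussAverage f t hR).aestronglyMeasurable ‖f‖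
    (Eventually.of_forall fun _ => norm_gaussAverage_le _ _ _)).integrableOn

/-- On the cell `mδ ≤ τ < (m+1)δ` the rounded time is the constant `(m+1)δ`, and the cell belongs to
the past of that time. The ordinary Markov property applies there; induction on `m` adds up the
cells. -/
lemma setIntegral_roundUp (h : IsBarrierMotion P X₀ B X Λ) (f : ℝ →ᵇ ℝ) {t δ : ℝ≥0}
    (hδ : 0 < δ) (m : ℕ) (hm : m * δ ≤ t) :
    ∫ ω in {ω | absorptionTime X ω < ((m * δ : ℝ≥0) : WithTop ℝ≥0)}, f (X₀ ω + B t ω) ∂P =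
      ∫ ω in {ω | absorptionTime X ω < ((m * δ : ℝ≥0) : WithTop ℝ≥0)},
        gaussAverage f (t - roundUp δ ((absorptionTime X ω).untopD 0))
          (X₀ ω + B (roundUp δ ((absorptionTime X ω).untopD 0)) ω) ∂P := by
  have hR : Measurable fun ω => roundUp δ ((absorptionTime X ω).untopD 0) :=
    (measurable_roundUp δ).comp h.measurable_untopD
  induction m with
  | zero =>
    have : {ω | absorptionTime X ω < ((((0 : ℕ) : ℝ≥0) * δ : ℝ≥0) : WithTop ℝ≥0)} = ∅ := by
      ext ω
      simp only [mem_ofPred_eq, mem_empty_iff_false, iff_false, not_lt, Nat.cast_zero, zero_mul]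
      exact le_hittingAfter ω
    simp only [this, Measure.restrict_empty, integral_zero_measure]
  | succ m ih =>
    have hle : (m : ℝ≥0) * δ ≤ (m + 1 : ℕ) * δ := by gcongr; simp
    specialize ih (hle.trans hm)
    set S := {ω | absorptionTime X ω < ((m * δ : ℝ≥0) : WithTop ℝ≥0)} with hS
    set S' := {ω | absorptionTime X ω < (((m + 1 : ℕ) * δ : ℝ≥0) : WithTop ℝ≥0)} with hS'
    have hSS : S ⊆ S' := fun ω (hω : _ < _) => hω.trans_le (WithTop.coe_le_coe.2 hle)
    have hSm : MeasurableSet S := h.measurableSet_lt _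
    have hS'm : MeasurableSet S' := h.measurableSet_lt _
    rw [← union_sdiff_cancel hSS, setIntegral_union disjoint_sdiff_right (hS'm.diff hSm)
      (h.integrableOn_comp f t _) (h.integrableOn_comp f t _),
      setIntegral_union disjoint_sdiff_right (hS'm.diff hSm)
      (h.integrableOn_gaussAverage f t hR _) (h.integrableOn_gaussAverage f t hR _), ih]
    congr 1
    rw [setIntegral_markov h.measurable_init h.measurable_noise h.brownian h.indep hm f
      ((h.measurableSet_past_lt _).diff
        (comap_past_mono X₀ B hle _ (h.measurableSet_past_lt _)))]
    refine setIntegral_congr_fun (hS'm.diff hSm) fun ω hω => ?_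
    obtain ⟨h1, h2⟩ := hω
    have h1' : absorptionTime X ω < (((m + 1 : ℕ) * δ : ℝ≥0) : WithTop ℝ≥0) := h1
    have h2' : ((m * δ : ℝ≥0) : WithTop ℝ≥0) ≤ absorptionTime X ω := not_lt.1 h2
    obtain ⟨T, hT⟩ := WithTop.ne_top_iff_exists.1 (h1'.trans_le le_top).ne
    rw [← hT, WithTop.coe_lt_coe] at h1'
    rw [← hT, WithTop.coe_le_coe] at h2'
    rw [← hT, WithTop.untopD_coe, roundUp_eq hδ h2' h1']

/-- The strong Markov property at the absorption time. -/
lemma setIntegral_strongMarkov (h : IsBarrierMotion P X₀ B X Λ) (f : ℝ →ᵇ ℝ) {t : ℝ≥0}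
    (ht : 0 < t) :
    ∫ ω in {ω | absorptionTime X ω < t}, f (X₀ ω + B t ω) ∂P =
      ∫ ω in {ω | absorptionTime X ω < t}, gaussAverage f (t - (absorptionTime X ω).untopD 0)
          (X₀ ω + B ((absorptionTime X ω).untopD 0) ω) ∂P := by
  -- The mesh divides `t`, so `t` is a grid point and the cells below it fill `{τ < t}` exactly.
  let δ : ℕ → ℝ≥0 := fun n => t / ((n + 1 : ℕ) : ℝ≥0)
  have hδ : ∀ n, 0 < δ n := fun n => by positivity
  have hδ0 : Tendsto δ atTop (𝓝 0) :=
    (tendsto_const_div_atTop_nhds_zero_nat t).comp (tendsto_add_atTop_nat 1)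
  have hR : ∀ n, Measurable fun ω => roundUp (δ n) ((absorptionTime X ω).untopD 0) := fun n =>
    (measurable_roundUp (δ n)).comp h.measurable_untopD
  have hn : ∀ n, ((n + 1 : ℕ) : ℝ≥0) * δ n = t := fun n => mul_div_cancel₀ t (by positivity)
  have hstep : ∀ n, ∫ ω in {ω | absorptionTime X ω < t}, f (X₀ ω + B t ω) ∂P =
      ∫ ω in {ω | absorptionTime X ω < t},
        gaussAverage f (t - roundUp (δ n) ((absorptionTime X ω).untopD 0))
          (X₀ ω + B (roundUp (δ n) ((absorptionTime X ω).untopD 0)) ω) ∂P := fun n => by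
    have := h.setIntegral_roundUp f (hδ n) (n + 1) (hn n).le
    rwa [hn n] at this
  refine tendsto_nhds_unique ((tendsto_const_nhds (f := atTop)).congr hstep) ?_
  refine tendsto_integral_of_dominated_convergence (fun _ => ‖f‖)
    (fun n => (h.measurable_gaussAverage f t (hR n)).aestronglyMeasurable) (integrable_const _)
    (fun n => Eventually.of_forall fun ω => norm_gaussAverage_le _ _ _)
    (Eventually.of_forall fun ω => ?_)
  -- The rounded times decrease to `τ` within a mesh size, and continuity of the noise and of
  -- `gaussAverage` passes to the limit.
  set T := (absorptionTime X ω).untopD 0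
  have hT : Tendsto (fun n => roundUp (δ n) T) atTop (𝓝 T) := by
    refine tendsto_of_tendsto_of_tendsto_of_le_of_le tendsto_const_nhds ?_
      (fun n => (lt_roundUp (hδ n) T).le) (fun n => roundUp_le (hδ n) T)
    simpa using tendsto_const_nhds.add hδ0
  have hc : Continuous fun s : ℝ≥0 => gaussAverage f (t - s) (X₀ ω + B s ω) :=
    (continuous_gaussAverage f).comp ((continuous_const.sub continuous_id).prodMk
      (continuous_const.add (h.continuous_noise ω)))
  exact (hc.tendsto T).comp hT

end IsBarrierMotion

/-- A law whose test integrals are averages of Gaussian integrals is a mixture of Gaussian laws. -/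
lemma map_eq_withDensity_of_gaussAverage {Ω : Type*} [MeasurableSpace Ω] {μ : Measure Ω}
    [IsFiniteMeasure μ] {Y m : Ω → ℝ} {r : Ω → ℝ≥0} (hY : Measurable Y) (hm : Measurable m)
    (hr : Measurable r) (hr0 : ∀ᵐ ω ∂μ, 0 < r ω)
    (h : ∀ f : ℝ →ᵇ ℝ, ∫ ω, f (Y ω) ∂μ = ∫ ω, gaussAverage f (r ω) (m ω) ∂μ) :
    μ.map Y = volume.withDensity fun x => ∫⁻ ω, gaussianPDF (m ω) (r ω) x ∂μ := by
  refine ext_of_forall_lintegral_eq_of_IsFiniteMeasure fun f => ?_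
  have hfm : Measurable fun x => (f x : ℝ≥0∞) := f.continuous.measurable.coe_nnreal_ennreal
  let g : ℝ →ᵇ ℝ := BoundedContinuousFunction.ofNormedAddCommGroup (fun x => (f x : ℝ))
    (NNReal.continuous_coe.comp f.continuous) (nndist f 0) fun x => by
      refine (Real.norm_of_nonneg (f x).coe_nonneg).trans_le ?_
      have := f.dist_coe_le_dist (g := 0) x
      simpa [NNReal.dist_eq] using this
  have hgm : Measurable g := g.continuous.measurable
  have hg0 : ∀ x, 0 ≤ g x := fun x => (f x).2
  have hgf : ∀ x, ENNReal.ofReal (g x) = f x := fun x => ENNReal.ofReal_coe_nnreal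
  have hpdf : Measurable fun p : Ω × ℝ => gaussianPDF (m p.1) (r p.1) p.2 :=
    measurable_uncurry_gaussianPDF.comp
      ((hm.comp measurable_fst).prodMk ((hr.comp measurable_fst).prodMk measurable_snd))
  have hpdf' : Measurable fun x => ∫⁻ ω, gaussianPDF (m ω) (r ω) x ∂μ := hpdf.lintegral_prod_left'
  have hga : Measurable fun ω => gaussAverage g (r ω) (m ω) :=
    (continuous_gaussAverage g).measurable.comp (hr.prodMk hm)
  have hga0 : ∀ ω, 0 ≤ gaussAverage g (r ω) (m ω) := fun ω => integral_nonneg fun z => hg0 _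
  calc ∫⁻ x, f x ∂(μ.map Y) = ∫⁻ ω, ENNReal.ofReal (g (Y ω)) ∂μ := by
        rw [lintegral_map hfm hY]
        simp_rw [hgf]
    _ = ENNReal.ofReal (∫ ω, g (Y ω) ∂μ) := by
        rw [ofReal_integral_eq_lintegral_ofReal _ (Eventually.of_forall fun ω => hg0 _)]
        exact Integrable.of_bound (hgm.comp hY).aestronglyMeasurable ‖g‖
          (Eventually.of_forall fun ω => g.norm_coe_le_norm _)
    _ = ∫⁻ ω, ENNReal.ofReal (gaussAverage g (r ω) (m ω)) ∂μ := by
        rw [h, ofReal_integral_eq_lintegral_ofReal _ (Eventually.of_forall hga0)]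
        exact Integrable.of_bound hga.aestronglyMeasurable ‖g‖
          (Eventually.of_forall fun ω => norm_gaussAverage_le _ _ _)
    _ = ∫⁻ ω, (∫⁻ x, gaussianPDF (m ω) (r ω) x * f x) ∂μ := by
        refine lintegral_congr_ae (hr0.mono fun ω hω => ?_)
        beta_reduce
        rw [gaussAverage_eq_integral_gaussianReal, ofReal_integral_eq_lintegral_ofReal _
          (Eventually.of_forall hg0), gaussianReal_of_var_ne_zero _ hω.ne',
          lintegral_withDensity_eq_lintegral_mul _ (measurable_gaussianPDF _ _)
            (hgm.ennreal_ofReal)]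
        · simp_rw [Pi.mul_apply, hgf]
        · exact Integrable.of_bound hgm.aestronglyMeasurable ‖g‖
            (Eventually.of_forall fun ω => g.norm_coe_le_norm _)
    _ = ∫⁻ x, (∫⁻ ω, gaussianPDF (m ω) (r ω) x * f x ∂μ) := by
        rw [lintegral_lintegral_swap]
        exact (hpdf.mul (hfm.comp measurable_snd)).aemeasurable
    _ = ∫⁻ x, f x ∂(volume.withDensity fun x => ∫⁻ ω, gaussianPDF (m ω) (r ω) x ∂μ) := by
        rw [lintegral_withDensity_eq_lintegral_mul _ hpdf' hfm]
        refine lintegral_congr fun x => ?_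
        rw [Pi.mul_apply]
        have hx : Measurable fun ω => gaussianPDF (m ω) (r ω) x := hpdf.comp measurable_prodMk_right
        exact lintegral_mul_const _ hx

end StrongMarkov

/-! ### Densities as heat potentials -/

/-- The density at `(t, x)` of the mass produced by the sources `ν` under the heat flow. -/
noncomputable def heatMass (ν : Measure (ℝ × ℝ)) (t x : ℝ) : ℝ≥0∞ :=
  ∫⁻ p, gaussianPDF p.2 (t - p.1).toNNReal x ∂ν

lemma gaussianPDFReal_zero_var (m x : ℝ) : gaussianPDFReal m 0 x = 0 := by
  simp [gaussianPDFReal]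

/-- The conventions match: for `r ≤ 0` the truncated variance is `0`, where the Gaussian density is
zero, like the extended kernel. -/
lemma heatJet_zero_complexify (p : ℝ × ℝ) :
    heatJet 0 (complexify p) = (gaussianPDFReal 0 p.1.toNNReal p.2 : ℂ) := by
  rcases le_or_gt p.1 0 with h | h
  · rw [heatJet_of_nonpos 0 (by exact h), Real.toNNReal_of_nonpos h, gaussianPDFReal_zero_var]
    simp
  · rw [heatJet, if_pos (by exact h), gaussianPDFReal, Real.coe_toNNReal _ h.le]
    simp [complexify]

lemma measurable_gaussianPDF_source :
    Measurable fun q : (ℝ × ℝ) × ℝ × ℝ =>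
      gaussianPDF q.2.2 (q.1.1 - q.2.1).toNNReal q.1.2 :=
  measurable_uncurry_gaussianPDF.comp
    (f := fun q : (ℝ × ℝ) × ℝ × ℝ => (q.2.2, (q.1.1 - q.2.1).toNNReal, q.1.2)) (by fun_prop)

lemma measurable_gaussianPDFReal_source (t x : ℝ) :
    Measurable fun p : ℝ × ℝ => gaussianPDFReal p.2 (t - p.1).toNNReal x := by
  have h : Measurable fun q : ℝ × ℝ≥0 × ℝ => gaussianPDFReal q.1 q.2.1 q.2.2 :=
    measurable_uncurry_gaussianPDFReal
  exact h.comp (f := fun p : ℝ × ℝ => (p.2, (t - p.1).toNNReal, x)) (by fun_prop)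

lemma measurable_heatMass (ν : Measure (ℝ × ℝ)) [SFinite ν] (t : ℝ) :
    Measurable (heatMass ν t) := by
  have h : Measurable fun q : ℝ × ℝ × ℝ => gaussianPDF q.2.2 (t - q.2.1).toNNReal q.1 :=
    measurable_gaussianPDF_source.comp
      (f := fun q : ℝ × ℝ × ℝ => ((t, q.1), q.2)) (by fun_prop)
  exact h.lintegral_prod_right'

lemma heatPotential_zero_complexify (ν : Measure (ℝ × ℝ)) (t x : ℝ) :
    heatPotential ν 0 (t, (x : ℂ)) = ((heatMass ν t x).toReal : ℂ) := by
  have h1 : ∀ p : ℝ × ℝ, heatJet 0 ((t, (x : ℂ)) - complexify p) =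
      (gaussianPDFReal p.2 (t - p.1).toNNReal x : ℂ) := fun p => by
    have h2 : ((t, (x : ℂ)) - complexify p) = complexify (t - p.1, x - p.2) := by
      simp [complexify]
    rw [h2, heatJet_zero_complexify, gaussianPDFReal_sub, zero_add]
  unfold heatPotential heatMass
  simp_rw [h1]
  rw [integral_complex_ofReal, integral_eq_lintegral_of_nonneg_ae
    (Eventually.of_forall fun p => gaussianPDFReal_nonneg _ _ _)
    (measurable_gaussianPDFReal_source t x).aestronglyMeasurable]
  rfl

/-- If a measure with a density splits in two and the first part has a density, then the second
part has the difference of the densities as its density. -/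
lemma eq_withDensity_sub {α : Type*} [MeasurableSpace α] {μ m₀ m₁ m₂ : Measure α} [SigmaFinite μ]
    [IsFiniteMeasure m₀] {V₀ V₁ : α → ℝ≥0∞} (hV₀ : Measurable V₀) (hV₁ : Measurable V₁)
    (h₀ : m₀ = μ.withDensity V₀) (h₁ : m₁ = μ.withDensity V₁) (h : m₁ + m₂ = m₀) :
    (∀ᵐ x ∂μ, 0 ≤ (V₀ x).toReal - (V₁ x).toReal) ∧
      m₂ = μ.withDensity fun x => ENNReal.ofReal ((V₀ x).toReal - (V₁ x).toReal) := by
  have hle : m₂ ≤ m₀ := h ▸ Measure.le_add_left le_rfl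
  have hfin : IsFiniteMeasure m₂ := isFiniteMeasure_of_le m₀ hle
  have hac : m₂ ≪ μ := (Measure.absolutelyContinuous_of_le hle).trans
    (h₀ ▸ withDensity_absolutelyContinuous _ _)
  have hg : μ.withDensity (m₂.rnDeriv μ) = m₂ := Measure.withDensity_rnDeriv_eq m₂ μ hac
  have hsum : V₁ + m₂.rnDeriv μ =ᵐ[μ] V₀ := by
    rw [← withDensity_eq_iff_of_sigmaFinite
      (hV₁.add (Measure.measurable_rnDeriv _ _)).aemeasurable hV₀.aemeasurable,
      withDensity_add_left hV₁, hg, ← h₁, h, h₀]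
  -- Finiteness almost everywhere allows the extended densities to be subtracted as real numbers.
  have hlt : ∀ᵐ x ∂μ, V₀ x < ∞ := by
    refine ae_lt_top hV₀ ?_
    have := measure_ne_top m₀ univ
    rwa [h₀, withDensity_apply _ MeasurableSet.univ, setLIntegral_univ] at this
  have key : ∀ᵐ x ∂μ, (V₀ x).toReal - (V₁ x).toReal = (m₂.rnDeriv μ x).toReal ∧
      m₂.rnDeriv μ x ≠ ∞ := by
    filter_upwards [hsum, hlt] with x hx hx'
    rw [← hx, Pi.add_apply] at hx'
    have h1 := (ENNReal.add_lt_top.1 hx').1.ne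
    have h2 := (ENNReal.add_lt_top.1 hx').2.ne
    rw [← hx, Pi.add_apply, ENNReal.toReal_add h1 h2]
    exact ⟨by ring, h2⟩
  refine ⟨key.mono fun x hx => hx.1 ▸ ENNReal.toReal_nonneg, ?_⟩
  refine hg.symm.trans (withDensity_congr_ae (key.mono fun x hx => ?_))
  beta_reduce
  rw [hx.1, ENNReal.ofReal_toReal hx.2]

namespace IsBarrierMotion

variable {Ω : Type*} [MeasurableSpace Ω] {P : Measure Ω}
  {X₀ : Ω → ℝ} {B X : ℝ≥0 → Ω → ℝ} {Λ : ℝ≥0 → ℝ}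

/-- The law on space-time of the starting point. -/
noncomputable def initialLaw (P : Measure Ω) (X₀ : Ω → ℝ) (B : ℝ≥0 → Ω → ℝ) : Measure (ℝ × ℝ) :=
  P.map fun ω => (0, X₀ ω + B 0 ω)

/-- The law on space-time of the point where the process `X₀ + B` is absorbed. -/
noncomputable def absorptionLaw (P : Measure Ω) (X₀ : Ω → ℝ) (B X : ℝ≥0 → Ω → ℝ) :
    Measure (ℝ × ℝ) :=
  (P.restrict {ω | absorptionTime X ω ≠ ⊤}).map fun ω =>
    ((((absorptionTime X ω).untopD 0 : ℝ≥0) : ℝ), X₀ ω + B ((absorptionTime X ω).untopD 0) ω)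

instance [IsProbabilityMeasure P] : IsFiniteMeasure (initialLaw P X₀ B) := by
  unfold initialLaw
  infer_instance

instance [IsProbabilityMeasure P] : IsFiniteMeasure (absorptionLaw P X₀ B X) := by
  unfold absorptionLaw
  infer_instance

lemma initialLaw_ae (h : IsBarrierMotion P X₀ B X Λ) : ∀ᵐ p ∂initialLaw P X₀ B, p.1 = 0 := by
  have hm : Measurable fun ω => ((0 : ℝ), X₀ ω + B 0 ω) :=
    measurable_const.prodMk (h.measurable_init.add (h.measurable_noise 0))
  rw [initialLaw, ae_map_iff hm.aemeasurable (measurableSet_eq_fun measurable_fst measurable_const)]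
  exact Eventually.of_forall fun _ => rfl

lemma measurable_absorptionPoint (h : IsBarrierMotion P X₀ B X Λ) :
    Measurable fun ω => ((((absorptionTime X ω).untopD 0 : ℝ≥0) : ℝ),
      X₀ ω + B ((absorptionTime X ω).untopD 0) ω) :=
  (measurable_coe_nnreal_real.comp h.measurable_untopD).prodMk (h.measurable_eval
      h.measurable_untopD)

/-- Absorption takes place below the barrier. -/
lemma absorptionLaw_ae (h : IsBarrierMotion P X₀ B X Λ) :
    ∀ᵐ p ∂absorptionLaw P X₀ B X, 0 ≤ p.1 ∧ p.2 ≤ Λ p.1.toNNReal := by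
  have hΛ : Measurable Λ := h.monotone.measurable
  rw [absorptionLaw, ae_map_iff h.measurable_absorptionPoint.aemeasurable,
    ae_restrict_iff' h.measurableSet_ne_top]
  · refine Eventually.of_forall fun ω hω => ⟨NNReal.coe_nonneg _, ?_⟩
    have := absorptionTime_untopD_mem (h.lowerSemicontinuous ω) hω
    rw [h.dynamics] at this
    simp only [Real.toNNReal_coe]
    linarith
  · exact (_root_.measurableSet_le measurable_const measurable_fst).inter
      (_root_.measurableSet_le measurable_snd (hΛ.comp (measurable_real_toNNReal.comp
          measurable_fst)))

variable [IsProbabilityMeasure P]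

/-- The law of `X₀ + B` at time `t`. -/
lemma map_eval (h : IsBarrierMotion P X₀ B X Λ) {t : ℝ≥0} (ht : 0 < t) :
    P.map (fun ω => X₀ ω + B t ω) = volume.withDensity (heatMass (initialLaw P X₀ B) t) := by
  have hm : Measurable fun ω => X₀ ω + B 0 ω := h.measurable_init.add (h.measurable_noise 0)
  rw [map_eq_withDensity_of_gaussAverage (Y := fun ω => X₀ ω + B t ω) (m := fun ω => X₀ ω + B 0 ω)
      (r := fun _ => t)
    (h.measurable_init.add (h.measurable_noise t)) hm measurable_const
    (Eventually.of_forall fun _ => ht)]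
  · congr 1
    ext x
    rw [heatMass, initialLaw, lintegral_map _ (measurable_const.prodMk hm)]
    · simp
    · exact measurable_gaussianPDF_source.comp
        (f := fun p : ℝ × ℝ => (((t : ℝ), x), p)) (by fun_prop)
  · intro f
    have := setIntegral_markov h.measurable_init h.measurable_noise h.brownian h.indep
      (zero_le : 0 ≤ t) f (A := univ) MeasurableSet.univ
    simpa using this

/-- The law of `X₀ + B` at time `t` when it has been absorbed before. -/
lemma map_eval_absorbed (h : IsBarrierMotion P X₀ B X Λ) {t : ℝ≥0} (ht : 0 < t) :
    (P.restrict {ω | absorptionTime X ω < t}).map (fun ω => X₀ ω + B t ω) =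
      volume.withDensity (heatMass (absorptionLaw P X₀ B X) t) := by
  rw [map_eq_withDensity_of_gaussAverage (Y := fun ω => X₀ ω + B t ω)
    (m := fun ω => X₀ ω + B ((absorptionTime X ω).untopD 0) ω)
    (r := fun ω => t - (absorptionTime X ω).untopD 0)
    (h.measurable_init.add (h.measurable_noise t)) (h.measurable_eval h.measurable_untopD)
    (measurable_const.sub h.measurable_untopD)]
  · congr 1
    ext x
    rw [heatMass, absorptionLaw, lintegral_map _ h.measurable_absorptionPoint]
    · have hsub : {ω | absorptionTime X ω < t} ⊆ {ω | absorptionTime X ω ≠ ⊤} :=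
        fun ω (hω : _ < _) => (hω.trans_le le_top).ne
      have h1 : ∀ ω, ((t : ℝ) - (((absorptionTime X ω).untopD 0 : ℝ≥0) : ℝ)).toNNReal =
          t - (absorptionTime X ω).untopD 0 := fun ω => (NNReal.sub_def).symm
      simp only [h1]
      rw [← lintegral_indicator (h.measurableSet_lt t), ← lintegral_indicator
          h.measurableSet_ne_top]
      refine lintegral_congr fun ω => ?_
      by_cases h2 : absorptionTime X ω < t
      · rw [indicator_of_mem (by exact h2), indicator_of_mem (hsub h2)]
      -- Paths absorbed at time `t` or later are counted by the absorption law, but their truncated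
      -- variance is `0` and they contribute nothing.
      · rw [indicator_of_notMem (by exact h2)]
        symm
        refine indicator_apply_eq_zero.2 fun h3 => ?_
        obtain ⟨T, hT⟩ := WithTop.ne_top_iff_exists.1 h3
        rw [← hT, WithTop.coe_lt_coe, not_lt] at h2
        rw [← hT, WithTop.untopD_coe, tsub_eq_zero_of_le h2, gaussianPDF, gaussianPDFReal_zero_var,
          ENNReal.ofReal_zero]
    · exact measurable_gaussianPDF_source.comp
        (f := fun p : ℝ × ℝ => (((t : ℝ), x), p)) (by fun_prop)
  · refine (ae_restrict_iff' (h.measurableSet_lt t)).2 (Eventually.of_forall fun ω hω => ?_)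
    have hω' : absorptionTime X ω < t := hω
    obtain ⟨T, hT⟩ := WithTop.ne_top_iff_exists.1 (hω'.trans_le le_top).ne
    rw [← hT, WithTop.coe_lt_coe] at hω'
    rw [← hT, WithTop.untopD_coe]
    exact tsub_pos_of_lt hω'
  · exact fun f => h.setIntegral_strongMarkov f ht

/-- The density at time `t` of the law of `X₀ + B` on the event of no absorption before `t`. -/
noncomputable def aliveDensity (P : Measure Ω) (X₀ : Ω → ℝ) (B X : ℝ≥0 → Ω → ℝ) (t x : ℝ) : ℝ :=
  (heatMass (initialLaw P X₀ B) t x).toReal - (heatMass (absorptionLaw P X₀ B X) t x).toReal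

/-- The law of `X₀ + B_t` splits over `{τ < t}` and its complement `{τ ≥ t}`; subtracting the first
part leaves the alive mass. -/
lemma map_eval_alive (h : IsBarrierMotion P X₀ B X Λ) {t : ℝ≥0} (ht : 0 < t) :
    (∀ᵐ x, 0 ≤ aliveDensity P X₀ B X t x) ∧
      (P.restrict {ω | t ≤ absorptionTime X ω}).map (fun ω => X₀ ω + B t ω) =
        volume.withDensity fun x => ENNReal.ofReal (aliveDensity P X₀ B X t x) := by
  have hY : Measurable fun ω => X₀ ω + B t ω := h.measurable_init.add (h.measurable_noise t)
  refine eq_withDensity_sub (measurable_heatMass _ _) (measurable_heatMass _ _) (h.map_eval ht)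
    (h.map_eval_absorbed ht) ?_
  have : {ω | t ≤ absorptionTime X ω} = {ω | absorptionTime X ω < t}ᶜ := by
    ext ω
    exact (not_lt (a := absorptionTime X ω) (b := (t : WithTop ℝ≥0))).symm
  rw [← Measure.map_add _ _ hY, this, Measure.restrict_add_restrict_compl (h.measurableSet_lt t)]

end IsBarrierMotion

variable {Ω : Type*} [MeasurableSpace Ω] {P : Measure Ω}
  {X₀ : Ω → ℝ} {B X : ℝ≥0 → Ω → ℝ} {Λ : ℝ≥0 → ℝ}

/-! ### Analyticity of the alive density -/

namespace IsBarrierMotion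

/-- The complexified space derivatives of the density of the alive mass, where only absorption
before time `T` is taken into account. -/
noncomputable def aliveJet (P : Measure Ω) (X₀ : Ω → ℝ) (B X : ℝ≥0 → Ω → ℝ) (T : ℝ) (n : ℕ)
    (q : ℝ × ℂ) : ℂ :=
  heatPotential (initialLaw P X₀ B) n q -
    heatPotential ((absorptionLaw P X₀ B X).restrict {p | p.1 < T}) n q

lemma aliveJet_zero {t T : ℝ} (h : t ≤ T) (x : ℝ) :
    aliveJet P X₀ B X T 0 (t, (x : ℂ)) = (aliveDensity P X₀ B X t x : ℂ) := by
  rw [aliveJet, heatPotential_restrict _ _ h, heatPotential_zero_complexify,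
    heatPotential_zero_complexify, aliveDensity, Complex.ofReal_sub]

lemma restrict_map_indicator {S : Set Ω} {Y : Ω → ℝ} (hS : MeasurableSet S) (hY : Measurable Y) :
    (P.map (S.indicator Y)).restrict (Ioi 0) = ((P.restrict S).map Y).restrict (Ioi 0) := by
  ext A hA
  have hA' : MeasurableSet (A ∩ Ioi (0 : ℝ)) := hA.inter measurableSet_Ioi
  rw [Measure.restrict_apply hA, Measure.restrict_apply hA, Measure.map_apply (hY.indicator hS) hA',
    Measure.map_apply hY hA', Measure.restrict_apply (hY hA')]
  congr 1
  ext ω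
  by_cases hω : ω ∈ S <;> simp [hω]

variable [IsProbabilityMeasure P]

/-- The barrier may exceed `a` after time `T`. Discarding the later sources leaves only those in `{y
≤ a}`, so the cone with apex `a` is a region of regularity. -/
lemma isHeatJet_aliveJet (h : IsBarrierMotion P X₀ B X Λ) {T a : ℝ}
    (ha : ∀ s : ℝ≥0, (s : ℝ) < T → Λ s ≤ a) :
    IsHeatJet (aliveJet P X₀ B X T) {q | 0 < q.1 ∧ 2 * |q.2.im| < q.2.re - a} := by
  refine (isHeatJet_heatPotential fun q hq => heatRegular_of_initial h.initialLaw_ae hq.1).sub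
    (isHeatJet_heatPotential fun q hq => heatRegular_of_le (a := a) ?_ hq.2)
  rw [ae_restrict_iff' (_root_.measurableSet_lt measurable_fst measurable_const)]
  refine h.absorptionLaw_ae.mono fun p hp hpT => ⟨hp.1, hp.2.trans (ha _ ?_)⟩
  rwa [Real.coe_toNNReal _ hp.1]

lemma isOpen_cone (a : ℝ) : IsOpen {q : ℝ × ℂ | 0 < q.1 ∧ 2 * |q.2.im| < q.2.re - a} :=
  (isOpen_lt continuous_const continuous_fst).and (isOpen_lt
    (f := fun q : ℝ × ℂ => 2 * |q.2.im|) (g := fun q => q.2.re - a) (by fun_prop) (by fun_prop))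

/-- Taking `T = t` keeps only absorption strictly before `t`, which happens at or below the left
limit of `Λ`. Analyticity thus reaches down to `Λ_{t-}`, as `ρ` needs; the truncated jet is regular
on both sides of time `t`, but is only compared with the density at `t` itself. -/
lemma analyticAt_aliveDensity (h : IsBarrierMotion P X₀ B X Λ) {t : ℝ≥0} (ht : 0 < t) {x : ℝ}
    (hx : Function.leftLim Λ t < x) : AnalyticAt ℝ (aliveDensity P X₀ B X t) x := by
  have h1 := h.isHeatJet_aliveJet (T := t) (a := Function.leftLim Λ t) fun s hs =>
    h.monotone.le_leftLim (by exact_mod_cast hs)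
  have h2 := h1.analyticAt_real (isOpen_cone _) (t := t) (x := x)
    ⟨by exact_mod_cast ht, by simpa using hx⟩
  simpa only [aliveJet_zero le_rfl, Complex.ofReal_re] using h2

lemma measurable_aliveDensity (t : ℝ) : Measurable (aliveDensity P X₀ B X t) :=
  (measurable_heatMass _ t).ennreal_toReal.sub (measurable_heatMass _ t).ennreal_toReal

lemma map_sub_withDensity {g : ℝ → ℝ≥0∞} (c : ℝ) :
    (volume.withDensity g).map (fun x => x - c) = volume.withDensity fun x => g (x + c) := by
  ext A hA
  have hm : Measurable fun x : ℝ => x - c := by fun_prop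
  rw [Measure.map_apply hm hA, withDensity_apply _ (hm hA), withDensity_apply _ hA]
  have := (measurePreserving_sub_right volume c).setLIntegral_comp_preimage_emb
    (MeasurableEquiv.subRight c).measurableEmbedding (fun x => g (x + c)) A
  simpa only [sub_add_cancel] using this

/-- Shifts of the alive density are densities of `X₀ + B - c` on the event of no absorption
before `t`. -/
lemma isSubdensity (h : IsBarrierMotion P X₀ B X Λ) {t : ℝ≥0} (ht : 0 < t) {c : ℝ}
    (hc : Function.leftLim Λ t ≤ c) {X' : ℝ≥0 → Ω → ℝ} {Y : Ω → ℝ}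
    (hX' : ∀ᵐ ω ∂P, absorptionTime X' ω = absorptionTime X ω)
    (hY : ∀ᵐ ω ∂P, Y ω = X₀ ω + B t ω - c) :
    IsSubdensity P (beforeAbsorption X' t Y) fun x => aliveDensity P X₀ B X t (x + c) := by
  set S : Set Ω := {ω | t ≤ absorptionTime X ω} with hS
  have hSm : MeasurableSet S := by
    have : S = {ω | absorptionTime X ω < t}ᶜ := by
      ext ω
      exact (not_lt (a := absorptionTime X ω) (b := (t : WithTop ℝ≥0))).symm
    rw [this]
    exact (h.measurableSet_lt t).compl
  have hBm : Measurable fun ω => X₀ ω + B t ω := h.measurable_init.add (h.measurable_noise t)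
  have hYm : Measurable fun ω => X₀ ω + B t ω - c := hBm.sub_const c
  have hae : beforeAbsorption X' t Y =ᵐ[P] S.indicator fun ω => X₀ ω + B t ω - c := by
    filter_upwards [hX', hY] with ω h1 h2
    simp only [beforeAbsorption, indicator, mem_ofPred_eq, h1, h2, hS]
  obtain ⟨hnn, hlaw⟩ := h.map_eval_alive ht
  have hcont : ContinuousOn (fun x => aliveDensity P X₀ B X t (x + c)) (Ioi 0) := fun x hx => by
    have hx' : 0 < x := hx
    exact ((h.analyticAt_aliveDensity ht (x := x + c) (by linarith)).continuousAt.comp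
      (f := fun y => y + c) (by fun_prop)).continuousWithinAt
  refine ⟨⟨_, hYm.indicator hSm, hae⟩,
    ((measurable_aliveDensity t).comp (measurable_add_const c)).aemeasurable, fun x hx => ?_, ?_⟩
  -- Nonnegativity is known only almost everywhere; continuity makes the density equal to its
  -- absolute value on the whole open half-line.
  · have h1 : ∀ᵐ y : ℝ, 0 ≤ aliveDensity P X₀ B X t (y + c) :=
      (measurePreserving_add_right volume c).quasiMeasurePreserving.ae hnn
    have h2 : EqOn (fun y => aliveDensity P X₀ B X t (y + c))
        (fun y => |aliveDensity P X₀ B X t (y + c)|) (Ioi 0) :=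
      Measure.eqOn_open_of_ae_eq (ae_restrict_of_ae (h1.mono fun y hy => (abs_of_nonneg hy).symm))
        isOpen_Ioi hcont hcont.abs
    exact (abs_nonneg _).trans_eq (h2 hx).symm
  · have h1 : (P.restrict S).map (fun ω => X₀ ω + B t ω - c) =
        volume.withDensity fun x => ENNReal.ofReal (aliveDensity P X₀ B X t (x + c)) := by
      rw [← map_sub_withDensity (g := fun x => ENNReal.ofReal (aliveDensity P X₀ B X t x)), ← hlaw,
          Measure.map_map (measurable_sub_const c) hBm]
      rfl
    rw [Measure.map_congr hae, restrict_map_indicator hSm hYm, h1,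
      restrict_withDensity measurableSet_Ioi]

end IsBarrierMotion

/-! ### From physical solutions to barrier motions -/

/-- Up to modification on a null set, a physical solution is a barrier motion. -/
lemma IsPhysicalSolution.exists_barrier_modification {α : ℝ} (h : IsPhysicalSolution P α X₀ B X Λ) :
    ∃ B' X' : ℝ≥0 → Ω → ℝ, IsBarrierMotion P X₀ B' X' Λ ∧
      ∀ᵐ ω ∂P, (∀ t, B t ω = B' t ω) ∧ (∀ t, X t ω = X' t ω) ∧ Continuous fun t => B t ω := by
  -- The set of discontinuous paths is null but need not be measurable; its measurable hull is, and
  -- the noise is replaced by zero there.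
  set N := (toMeasurable P {ω | ¬Continuous fun t => B t ω})ᶜ with hN
  have hNm : MeasurableSet N := (measurableSet_toMeasurable _ _).compl
  have hNae : ∀ᵐ ω ∂P, ω ∈ N := by
    rw [ae_iff]
    have : {ω | ω ∉ N} = toMeasurable P {ω | ¬Continuous fun t => B t ω} := by
      ext ω
      simp [hN]
    rw [this, measure_toMeasurable]
    exact h.brownian.cont
  have hNc : ∀ ω ∈ N, Continuous fun t => B t ω := fun ω hω => by
    by_contra hn
    exact hω (subset_toMeasurable _ _ hn)
  let B' : ℝ≥0 → Ω → ℝ := fun t => N.indicator (B t)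
  have hB' : ∀ ω ∈ N, ∀ t, B t ω = B' t ω := fun ω hω t => (indicator_of_mem hω _).symm
  refine ⟨B', fun t ω => X₀ ω + B' t ω - Λ t, ⟨h.measurable_init,
    fun t => (h.measurable_noise t).indicator hNm, ?_, fun ω => ?_, ?_, h.monotone,
    h.right_continuous, fun t ω => rfl⟩, ?_⟩
  · exact h.brownian.toIsPreBrownianReal.congr fun t => hNae.mono fun ω hω => hB' ω hω t
  · by_cases hω : ω ∈ N
    · simpa only [hB' ω hω] using hNc ω hω
    · simpa only [B', indicator_of_notMem hω] using continuous_const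
  · exact h.indep.congr (ae_eq_refl _) (hNae.mono fun ω hω => funext (hB' ω hω))
  · filter_upwards [hNae] with ω hω
    exact ⟨hB' ω hω, fun t => by rw [h.dynamics, hB' ω hω], hNc ω hω⟩

lemma absorptionTime_congr {Ω : Type*} {X X' : ℝ≥0 → Ω → ℝ} {ω : Ω} (h : ∀ t, X t ω = X' t ω) :
    absorptionTime X ω = absorptionTime X' ω := by
  by_cases hv : ∃ v, X v ω ≤ 0
  · rw [absorptionTime_eq_coe_of_mem hv, absorptionTime_eq_coe_of_mem (by simpa only [h] using hv)]
    simp only [h]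
  · have hv' : ¬∃ v, X' v ω ≤ 0 := by simpa only [h] using hv
    rw [not_imp_comm.1 exists_of_absorptionTime_ne_top hv,
      not_imp_comm.1 exists_of_absorptionTime_ne_top hv']

lemma IsPhysicalSolution.leftValue_eq {α : ℝ} (h : IsPhysicalSolution P α X₀ B X Λ) {ω : Ω}
    (hω : Continuous fun t => B t ω) {t : ℝ≥0} (ht : 0 < t) :
    leftValue X₀ X t ω = X₀ ω + B t ω - Function.leftLim Λ t := by
  have : (𝓝[<] t).NeBot := nhdsLT_neBot_of_exists_lt ⟨0, ht⟩
  rw [leftValue, if_neg ht.ne']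
  refine leftLim_eq_of_tendsto ?_
  simp_rw [h.dynamics]
  exact ((continuous_const.add hω).continuousWithinAt.tendsto).sub (h.monotone.tendsto_leftLim t)

end SupercooledStefan

/-! ### Conclusion -/

open SupercooledStefan

theorem mainTheorem4 {Ω : Type*} [MeasurableSpace Ω] (P : Measure Ω) [IsProbabilityMeasure P]
    (α : ℝ) (hα : 0 < α) (X₀ : Ω → ℝ) (B X : ℝ≥0 → Ω → ℝ) (Λ : ℝ≥0 → ℝ)
    (h : SupercooledStefan.IsPhysicalSolution P α X₀ B X Λ) :
    ∃ p ρ : ℝ≥0 → ℝ → ℝ,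
      (∀ t : ℝ≥0, 0 < t →
        SupercooledStefan.IsSubdensity P (SupercooledStefan.beforeAbsorption X t (X t)) (p t) ∧
        SupercooledStefan.IsSubdensity P
          (SupercooledStefan.beforeAbsorption X t (SupercooledStefan.leftValue X₀ X t)) (ρ t)) ∧
      ContDiffOn ℝ (⊤ : ℕ∞) (fun q : ℝ × ℝ => SupercooledStefan.shiftedDensity p Λ q.1 q.2)
        (SupercooledStefan.liquidRegion Λ) ∧
      (∀ t x : ℝ, (t, x) ∈ SupercooledStefan.liquidRegion Λ →
        deriv (fun s => SupercooledStefan.shiftedDensity p Λ s x) t =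
          1 / 2 * iteratedDeriv 2 (fun y => SupercooledStefan.shiftedDensity p Λ t y) x) ∧
      (∀ t x : ℝ, (t, x) ∈ SupercooledStefan.liquidRegion Λ →
        SupercooledStefan.HasLocalComplexExtensions (SupercooledStefan.shiftedDensity p Λ)
          (SupercooledStefan.liquidRegion Λ) t x) ∧
      (∀ t : ℝ≥0, 0 < t →
        AnalyticOnNhd ℝ (SupercooledStefan.shiftedDensity p Λ t) (Ioi (Λ t)) ∧
        AnalyticOnNhd ℝ (p t) (Ioi 0) ∧
        AnalyticOnNhd ℝ (ρ t) (Ioi 0)) := by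
  obtain ⟨B', X', hb, hae⟩ := h.exists_barrier_modification
  -- One function serves both densities: `p` is its shift by `Λ_t`, and `ρ` its shift by `Λ_{t-}`.
  let u : ℝ → ℝ → ℝ := IsBarrierMotion.aliveDensity P X₀ B' X'
  let p : ℝ≥0 → ℝ → ℝ := fun t x => u t (x + Λ t)
  have hp : ∀ s y : ℝ, 0 ≤ s → shiftedDensity p Λ s y = u s y := fun s y hs => by
    simp only [shiftedDensity, p, Real.coe_toNNReal _ hs, sub_add_cancel]
  have hτ : ∀ᵐ ω ∂P, absorptionTime X ω = absorptionTime X' ω :=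
    hae.mono fun ω hω => absorptionTime_congr hω.2.1
  have hloc : ∀ t x : ℝ, (t, x) ∈ liquidRegion Λ → ∃ (F : ℕ → ℝ × ℂ → ℂ) (U : Set (ℝ × ℂ)),
      IsOpen U ∧ (t, (x : ℂ)) ∈ U ∧ IsHeatJet F U ∧
      (∀ s y : ℝ, (s, (y : ℂ)) ∈ U → (s, y) ∈ liquidRegion Λ) ∧
      ∀ s y : ℝ, (s, (y : ℂ)) ∈ U → F 0 (s, (y : ℂ)) = (shiftedDensity p Λ s y : ℂ) := by
    rintro t x ⟨ht, hx, htx⟩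
    simp only at ht hx htx
    -- Right-continuity leaves room after `t`: up to `T` the barrier stays below `x`, so a full
    -- space-time neighborhood of `(t, x)` is separated from the sources.
    obtain ⟨T, htT, hTx⟩ : ∃ T : ℝ≥0, t.toNNReal < T ∧ Λ T < x :=
      (((h.right_continuous t.toNNReal).mono Ioi_subset_Ici_self).eventually_lt_const htx
        |>.and self_mem_nhdsWithin).exists.imp fun T hT => ⟨hT.2, hT.1⟩
    have htT' : t < T := (Real.toNNReal_lt_iff_lt_coe ht.le).1 htT
    refine ⟨IsBarrierMotion.aliveJet P X₀ B' X' T,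
      {q | 0 < q.1 ∧ 2 * |q.2.im| < q.2.re - Λ T} ∩ {q | q.1 < T ∧ 0 < q.2.re},
      (IsBarrierMotion.isOpen_cone _).inter ((isOpen_lt continuous_fst continuous_const).and
        (isOpen_lt continuous_const (Complex.continuous_re.comp continuous_snd))), ?_, ?_, ?_, ?_⟩
    · exact ⟨⟨ht, by simpa using hTx⟩, htT', by simpa using hx⟩
    · exact (hb.isHeatJet_aliveJet fun s hs => h.monotone (by exact_mod_cast hs.le)).mono
        inter_subset_left
    · rintro s y ⟨⟨h1, h2⟩, h3, h4⟩
      simp only [Complex.ofReal_im, abs_zero, mul_zero, Complex.ofReal_re, sub_pos] at h1 h2 h3 h4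
      refine ⟨h1, h4, lt_of_le_of_lt (h.monotone ?_) h2⟩
      exact Real.toNNReal_le_iff_le_coe.2 h3.le
    · rintro s y ⟨⟨h1, -⟩, h3, -⟩
      rw [IsBarrierMotion.aliveJet_zero (le_of_lt h3), hp s y (le_of_lt h1)]
  have hre : ∀ {F : ℕ → ℝ × ℂ → ℂ} {U : Set (ℝ × ℂ)}, (∀ s y : ℝ, (s, (y : ℂ)) ∈ U →
      F 0 (s, (y : ℂ)) = (shiftedDensity p Λ s y : ℂ)) → ∀ s y : ℝ, (s, (y : ℂ)) ∈ U →
      shiftedDensity p Λ s y = (F 0 (s, (y : ℂ))).re := fun hF s y hs => by simp [hF s y hs]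
  have hpan : ∀ {t : ℝ≥0} {c : ℝ}, 0 < t → Function.leftLim Λ t ≤ c →
      AnalyticOnNhd ℝ (fun x => u t (x + c)) (Ioi 0) := fun {t c} ht hc x hx => by
    have hx' : 0 < x := hx
    exact (hb.analyticAt_aliveDensity ht (x := x + c) (by linarith)).comp
      (f := fun y => y + c) (analyticAt_id.add analyticAt_const)
  refine ⟨p, fun t x => u t (x + Function.leftLim Λ t), fun t ht => ⟨?_, ?_⟩, ?_, ?_, ?_,
    fun t ht => ⟨?_, hpan ht (h.monotone.leftLim_le le_rfl), hpan ht le_rfl⟩⟩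
  · exact hb.isSubdensity ht (h.monotone.leftLim_le le_rfl) hτ
      (hae.mono fun ω hω => by rw [h.dynamics, hω.1])
  · exact hb.isSubdensity ht le_rfl hτ
      (hae.mono fun ω hω => by rw [h.leftValue_eq hω.2.2 ht, hω.1])
  · rintro ⟨t, x⟩ hq
    obtain ⟨F, U, hU, hmem, hF, -, hFu⟩ := hloc t x hq
    refine ContDiffAt.contDiffWithinAt (contDiffAt_infty.2 fun m => ?_)
    refine (hF.contDiffAt hU (q := (t, x)) hmem m 0).congr_of_eventuallyEq ?_
    filter_upwards [(hU.preimage continuous_complexify).mem_nhds hmem] with q hq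
    exact hre hFu q.1 q.2 hq
  · intro t x hq
    obtain ⟨F, U, hU, hmem, hF, -, hFu⟩ := hloc t x hq
    have h1 : (fun s => shiftedDensity p Λ s x) =ᶠ[𝓝 t] fun s => (F 0 (s, (x : ℂ))).re := by
      filter_upwards [(hU.preimage (by fun_prop : Continuous fun s : ℝ => (s, (x : ℂ)))).mem_nhds
        hmem] with s hs
      exact hre hFu s x hs
    have h2 : (fun y => shiftedDensity p Λ t y) =ᶠ[𝓝 x] fun y => (F 0 (t, (y : ℂ))).re := by
      filter_upwards [(hU.preimage (by fun_prop : Continuous fun y : ℝ => (t, (y : ℂ)))).mem_nhds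
        hmem] with y hy
      exact hre hFu t y hy
    rw [h1.deriv_eq, h2.iteratedDeriv_eq, hF.heat_equation hU hmem]
  · intro t x hq
    obtain ⟨F, U, hU, hmem, hF, hD, hFu⟩ := hloc t x hq
    exact hF.hasLocalComplexExtensions hU hFu hD hmem
  · intro x hx
    have h1 : shiftedDensity p Λ t = u t := funext fun y => hp t y t.2
    rw [h1]
    exact hb.analyticAt_aliveDensity ht ((h.monotone.leftLim_le le_rfl).trans_lt hx)
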